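/- Let $(\Omega,\mu)$ be any measure space. For a real number $p\neq 0$ and a measurable real- or complex-valued function $f$ on $\Omega$ write $\|f\|_p:=\left(\int|f|^p\,d\mu\right)^{1/p}\in[0,\infty]$ (with $0^p=\infty$ if $p<0$), and put $$\widetilde\Gamma:=\|fg\|_{p/2}\left(\frac{\|f\|_p^p+\|g\|_p^p}{2}\right)^{-2/p}.$$ In the inequality below, the quotient is read as $0$ if $p>0$ and its denominator is $0$ or $\infty$, and also if $\mu=0$. **Inequality.** For all $p\in(0,1]\cup[2,\infty)$ and all measurable real- or complex-valued $f,g$ on $\Omega$, $$\int|f+g|^p\,d\mu\;\le\;\left(1+\frac{2^{2/p}\|fg\|_{p/2}}{\left(\|f\|_p^p+\|g\|_p^p\right)^{2/p}}\right)^{p-1}\int\left(|f|^p+|g|^p\right)d\mu .\qquad(*)$$ The reverse of $(*)$ holds if $p<0$ and $\int|f|^p\,d\mu,\ \int|g|^p\,d\mu<\infty$. It also holds if $p\in(1,2)$ and $f,g$ are real-valued with $f,g\ge0$ almost everywhere (in particular if $f,g>0$ almost everywhere). **Sharpness.** Replace the quotient in $(*)$, which equals $\widetilde\Gamma$, by $\widetilde\Gamma^{\,q}$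 with $q\in\mathbb R$. The resulting inequality is false in general if $p>2$ and $q>1$, and if $p\in(0,1)$ and $q<1$. The resulting reversed inequality is false in general if $p<0$ and $q<1$, and if $p\in(1,2]$ and $q<1$. In each of these cases, on every measure space with $0<\mu(\Omega)<\infty$ there are measurable functions $f,g>0$ with $\int f^p\,d\mu,\int g^p\,d\mu<\infty$ that violate it. **Equality.** Suppose $\int|f|^p\,d\mu<\infty$ and $\int|g|^p\,d\mu<\infty$. If $p>0$, $p\ne1,2$ (and, for $p\in(1,2)$, $f,g\ge0$ almost everywhere), then equality holds in $(*)$ if and only if $f$ and $g$ have disjoint supports up to a null set or $f=g$ almost everywhere. If $p<0$, then equality holds in $(*)$ if and only if $f=g$ almost everywhere. -/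

import Mathlib

open MeasureTheory
open scoped ENNReal

noncomputable section

/-- The integral `∫ |f|^p` for a real exponent `p`, valued in `[0, ∞]`.
For `p < 0` the convention is `|0|^p = ∞`. -/
def absPowInt {Ω 𝕜 : Type*} [MeasurableSpace Ω] [RCLike 𝕜]
    (p : ℝ) (f : Ω → 𝕜) (μ : Measure Ω) : ℝ≥0∞ :=
  ∫⁻ x, ‖f x‖ₑ ^ p ∂μ

/-- `‖f‖_p = (∫ |f|^p)^(1/p)` for every real `p ≠ 0`, negative `p` included. -/
def pNorm {Ω 𝕜 : Type*} [MeasurableSpace Ω] [RCLike 𝕜]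
    (p : ℝ) (f : Ω → 𝕜) (μ : Measure Ω) : ℝ≥0∞ :=
  (absPowInt p f μ) ^ (1 / p)

/-- The right-hand side of the main inequality:
`(1 + 2^(2/p) ‖fg‖_{p/2} / (‖f‖_p^p + ‖g‖_p^p)^(2/p))^(p-1) * ∫ (|f|^p + |g|^p)`. -/
def mainRHS {Ω 𝕜 : Type*} [MeasurableSpace Ω] [RCLike 𝕜]
    (p : ℝ) (f g : Ω → 𝕜) (μ : Measure Ω) : ℝ≥0∞ :=
  (1 + (2 : ℝ≥0∞) ^ (2 / p) * pNorm (p / 2) (fun x => f x * g x) μ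
      / (pNorm p f μ ^ p + pNorm p g μ ^ p) ^ (2 / p)) ^ (p - 1)
    * ∫⁻ x, (‖f x‖ₑ ^ p + ‖g x‖ₑ ^ p) ∂μ

/-- The overlap parameter `Γ̃ = ‖fg‖_{p/2} ((‖f‖_p^p + ‖g‖_p^p) / 2)^(-2/p)`. -/
def overlap {Ω 𝕜 : Type*} [MeasurableSpace Ω] [RCLike 𝕜]
    (p : ℝ) (f g : Ω → 𝕜) (μ : Measure Ω) : ℝ≥0∞ :=
  pNorm (p / 2) (fun x => f x * g x) μ
    * ((pNorm p f μ ^ p + pNorm p g μ ^ p) / 2) ^ (-(2 / p))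

/-- The right-hand side of the main inequality with `Γ̃` raised to the power `q`:
`(1 + Γ̃^q)^(p-1) * ∫ (|f|^p + |g|^p)`. -/
def powerRHS {Ω 𝕜 : Type*} [MeasurableSpace Ω] [RCLike 𝕜]
    (p q : ℝ) (f g : Ω → 𝕜) (μ : Measure Ω) : ℝ≥0∞ :=
  (1 + overlap p f g μ ^ q) ^ (p - 1) * ∫⁻ x, (‖f x‖ₑ ^ p + ‖g x‖ₑ ^ p) ∂μ

end

open Real Filter Topology

/-! Put x = |f|, y = |g|, B(t) = (1 + t^(2/p))^(p-1) (`overlapBound`), and let t = 2(xy)^(p/2)/(x^p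
+ y^p) be the pointwise overlap, which lies in [0,1]. Its average s for the weight x^p + y^p is the
overlap of the integrals, and the factor in the theorem is B(s). Two facts carry the proof. On
(0,1], B is strictly concave if p(p-1)(p-2) > 0 and strictly convex if it is negative; and (x+y)^p
is at most, respectively at least, B(t)(x^p + y^p). Since the directions agree, Jensen's inequality,
in the form of the tangent to B at s, yields the bound `tangent_bound`, which is linear in x^p + y^p
and (xy)^(p/2). It integrates to the theorem for |f| + |g| (`integral_bound`), and its strictness
for x ≠ y settles equality.

For the pointwise inequality, write x/y = e^(2u), so that t = 1/cosh(pu). The logarithm of the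
quotient of the two sides is `logDeficit p 1 u`. After multiplication by p(p-1)(2-p) it starts at 0,
tends to 0 or ∞, and its derivative can change sign only from plus to minus; hence it is positive
for u ≠ 0 (`logDeficit_sign`). The sign change is controlled by reducing, through one logarithm and
one more differentiation, to a sum of four hyperbolic sines, whose frequencies are removed by the
operators w'' - l²w.

The triangle inequality passes from |f| + |g| to f + g; its direction is the right one except for p
in (1,2), where nonnegativity replaces it. For sharpness, the second derivative of `logDeficit p q`
at 0 is p(p-1)(q-1), so constant functions that are nearly equal violate the inequality. -/

/-! ### Functions with a single sign change. -/

/-- A function on `(0, ∞)` that, once nonpositive, is negative from then on. -/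
def SingleCrossing (h : ℝ → ℝ) : Prop :=
  ∀ s t : ℝ, 0 < s → s < t → h s ≤ 0 → h t < 0

theorem SingleCrossing.congr_sign {h k : ℝ → ℝ} (hh : SingleCrossing h)
    (h₁ : ∀ u, 0 < u → k u ≤ 0 → h u ≤ 0) (h₂ : ∀ u, 0 < u → h u < 0 → k u < 0) :
    SingleCrossing k := fun s t hs hst hk =>
  h₂ t (hs.trans hst) (hh s t hs hst (h₁ s hs hk))

theorem SingleCrossing.mul_pos {h k m : ℝ → ℝ} (hh : SingleCrossing h)
    (hm : ∀ u, 0 < u → 0 < m u) (hk : ∀ u, 0 < u → k u = m u * h u) : SingleCrossing k := by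
  refine hh.congr_sign (fun u hu h0 => ?_) (fun u hu h0 => ?_)
  · rw [hk u hu] at h0
    exact nonpos_of_mul_nonpos_right h0 (hm u hu)
  · rw [hk u hu]
    exact mul_neg_of_pos_of_neg (hm u hu) h0

theorem exists_deriv_nonpos_of_nonpos {h h' : ℝ → ℝ} {l : ℝ}
    (hd : ∀ u, 0 < u → HasDerivAt h (h' u) u)
    (hl : Tendsto h (𝓝[>] 0) (𝓝 l)) (hl0 : 0 ≤ l) {s : ℝ} (hs : 0 < s) (h0 : h s ≤ 0) :
    ∃ ξ, 0 < ξ ∧ ξ < s ∧ h' ξ ≤ 0 := by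
  by_contra! hcon
  have hmono : StrictMonoOn h (Set.Ioc 0 s) := by
    refine strictMonoOn_of_deriv_pos (convex_Ioc 0 s)
      (fun u hu => (hd u hu.1).continuousAt.continuousWithinAt) (fun u hu => ?_)
    rw [interior_Ioc] at hu
    rw [(hd u hu.1).deriv]
    exact hcon u hu.1 hu.2
  have h1 : h (s / 2) < h s := hmono ⟨by linarith, by linarith⟩ ⟨hs, le_rfl⟩ (by linarith)
  have h2 : l ≤ h (s / 2) := by
    refine le_of_tendsto hl ?_
    filter_upwards [Ioo_mem_nhdsGT (show (0 : ℝ) < s / 2 by linarith)] with u hu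
    exact (hmono ⟨hu.1, by linarith [hu.2]⟩ ⟨by linarith, by linarith⟩ hu.2).le
  linarith

theorem strictAntiOn_of_singleCrossing_deriv {h h' : ℝ → ℝ}
    (hd : ∀ u, 0 < u → HasDerivAt h (h' u) u) (hsc : SingleCrossing h') {ξ : ℝ} (hξ : 0 < ξ)
    (h0 : h' ξ ≤ 0) : StrictAntiOn h (Set.Ici ξ) := by
  refine strictAntiOn_of_deriv_neg (convex_Ici ξ)
    (fun u hu => (hd u (hξ.trans_le hu)).continuousAt.continuousWithinAt) (fun u hu => ?_)
  rw [interior_Ici] at hu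
  rw [(hd u (hξ.trans hu)).deriv]
  exact hsc ξ u hξ hu h0

/-- A function that starts at a nonnegative level and reaches a nonpositive value has a nonpositive
derivative somewhere before. From there on the derivative is negative, so the function keeps
decreasing. -/
theorem SingleCrossing.of_deriv {h h' : ℝ → ℝ} {l : ℝ}
    (hd : ∀ u, 0 < u → HasDerivAt h (h' u) u)
    (hl : Tendsto h (𝓝[>] 0) (𝓝 l)) (hl0 : 0 ≤ l) (hsc : SingleCrossing h') :
    SingleCrossing h := by
  intro s t hs hst h0
  obtain ⟨ξ, hξ, hξs, hξ0⟩ := exists_deriv_nonpos_of_nonpos hd hl hl0 hs h0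
  have := strictAntiOn_of_singleCrossing_deriv hd hsc hξ hξ0 hξs.le (hξs.le.trans hst.le) hst
  linarith

/-- A nonpositive value would force strict decrease from then on, leaving the function below a fixed
negative number, against its behaviour at infinity. -/
theorem pos_of_singleCrossing_deriv {h h' : ℝ → ℝ} {l : ℝ}
    (hd : ∀ u, 0 < u → HasDerivAt h (h' u) u)
    (hl : Tendsto h (𝓝[>] 0) (𝓝 l)) (hl0 : 0 ≤ l) (hsc : SingleCrossing h')
    (hinf : ∀ δ > 0, ∀ᶠ u in atTop, -δ < h u) {s : ℝ} (hs : 0 < s) : 0 < h s := by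
  by_contra! h0
  obtain ⟨ξ, hξ, hξs, hξ0⟩ := exists_deriv_nonpos_of_nonpos hd hl hl0 hs h0
  have hanti := strictAntiOn_of_singleCrossing_deriv hd hsc hξ hξ0
  have h1 : h (s + 1) < h s := hanti hξs.le (by simp; linarith) (by linarith)
  obtain ⟨u, hu, hu'⟩ :=
    ((hinf (-h (s + 1)) (by linarith)).and (eventually_gt_atTop (s + 1))).exists
  have h2 : h u < h (s + 1) := hanti (by simp; linarith) (by simp; linarith) hu'
  linarith

/-- The operator factors as D² - c² = (D + c)(D - c). With the integrating factors e^(cu) and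
e^(-cu), each first-order factor becomes a plain derivative, and `SingleCrossing.of_deriv` applies
twice. -/
theorem SingleCrossing.of_second_order {w w₁ w₂ : ℝ → ℝ} (c : ℝ)
    (hw : ∀ u, HasDerivAt w (w₁ u) u) (hw₁ : ∀ u, HasDerivAt w₁ (w₂ u) u)
    (h0 : w 0 = 0) (h1 : 0 ≤ w₁ 0) (hsc : SingleCrossing fun u => w₂ u - c ^ 2 * w u) :
    SingleCrossing w := by
  have hexp : ∀ a u : ℝ, HasDerivAt (fun v => exp (a * v)) (exp (a * u) * a) u := fun a u => by
    simpa using ((hasDerivAt_id u).const_mul a).exp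
  have hY : SingleCrossing fun u => exp (c * u) * (w₁ u - c * w u) := by
    have hd : ∀ u, HasDerivAt (fun u => exp (c * u) * (w₁ u - c * w u))
        (exp (c * u) * (w₂ u - c ^ 2 * w u)) u := fun u => by
      refine ((hexp c u).mul ((hw₁ u).sub ((hw u).const_mul c))).congr_deriv ?_
      simp only [Pi.sub_apply]
      ring
    refine SingleCrossing.of_deriv (fun u _ => hd u)
      ((hd 0).continuousAt.tendsto.mono_left nhdsWithin_le_nhds) ?_
      (hsc.mul_pos (fun u _ => exp_pos _) (fun u _ => rfl))
    simpa [h0] using h1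
  have hd : ∀ u, HasDerivAt (fun u => exp (-c * u) * w u)
      (exp (-c * u) * (w₁ u - c * w u)) u := fun u => by
    refine ((hexp (-c) u).mul (hw u)).congr_deriv ?_
    ring
  have hZ : SingleCrossing fun u => exp (-c * u) * w u := by
    refine SingleCrossing.of_deriv (fun u _ => hd u)
      ((hd 0).continuousAt.tendsto.mono_left nhdsWithin_le_nhds) (by simp [h0])
      (hY.mul_pos (m := fun u => exp (-c * u) * exp (-c * u)) (fun u _ => by positivity)
        (fun u _ => ?_))
    rw [← mul_assoc, mul_assoc (exp _), ← exp_add]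
    simp
  refine hZ.mul_pos (m := fun u => exp (c * u)) (fun u _ => exp_pos _) (fun u _ => ?_)
  rw [← mul_assoc, ← exp_add]
  simp

/-! ### Sums of hyperbolic sines. -/

theorem hasDerivAt_sinh_mul (a u : ℝ) :
    HasDerivAt (fun v => sinh (a * v)) (a * cosh (a * u)) u := by
  simpa [mul_comm] using ((hasDerivAt_id u).const_mul a).sinh

theorem hasDerivAt_cosh_mul (a u : ℝ) :
    HasDerivAt (fun v => cosh (a * v)) (a * sinh (a * u)) u := by
  simpa [mul_comm] using ((hasDerivAt_id u).const_mul a).cosh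

theorem pos_of_deriv_pos {h h' : ℝ → ℝ} (hd : ∀ u, HasDerivAt h (h' u) u) (h0 : h 0 = 0)
    (hpos : ∀ u, 0 < u → 0 < h' u) {u : ℝ} (hu : 0 < u) : 0 < h u := by
  have hmono : StrictMonoOn h (Set.Ici 0) := by
    refine strictMonoOn_of_deriv_pos (convex_Ici 0)
      (fun u _ => (hd u).continuousAt.continuousWithinAt) (fun u hu => ?_)
    rw [interior_Ici] at hu
    rw [(hd u).deriv]
    exact hpos u hu
  simpa [h0] using hmono Set.self_mem_Ici hu.le hu

/-- The quotient sinh(bu)/sinh(au) is strictly increasing: the numerator of its derivative vanishes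
at 0 and has derivative (b² - a²) sinh(au) sinh(bu) > 0. -/
theorem sinh_mul_sinh_mul_lt {a b s t : ℝ} (ha : 0 < a) (hab : a < b) (hs : 0 < s) (hst : s < t) :
    sinh (a * t) * sinh (b * s) < sinh (a * s) * sinh (b * t) := by
  have hb := ha.trans hab
  have key : ∀ u, 0 < u → 0 < b * cosh (b * u) * sinh (a * u) - a * cosh (a * u) * sinh (b * u) := by
    intro u hu
    refine pos_of_deriv_pos
      (h := fun u => b * cosh (b * u) * sinh (a * u) - a * cosh (a * u) * sinh (b * u))
      (h' := fun u => (b ^ 2 - a ^ 2) * (sinh (a * u) * sinh (b * u))) (fun v => ?_)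
      (by simp) (fun v hv => ?_) hu
    · refine ((((hasDerivAt_cosh_mul b v).const_mul b).mul (hasDerivAt_sinh_mul a v)).sub
        (((hasDerivAt_cosh_mul a v).const_mul a).mul (hasDerivAt_sinh_mul b v))).congr_deriv ?_
      ring
    · have h1 : 0 < sinh (a * v) := sinh_pos_iff.2 (by positivity)
      have h2 : 0 < sinh (b * v) := sinh_pos_iff.2 (by positivity)
      have h3 : 0 < b ^ 2 - a ^ 2 := by nlinarith
      positivity
  have hsp : ∀ c u : ℝ, 0 < c → 0 < u → 0 < sinh (c * u) := fun c u hc hu =>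
    sinh_pos_iff.2 (by positivity)
  have hmono : StrictMonoOn (fun u => sinh (b * u) / sinh (a * u)) (Set.Ioi 0) := by
    have hd : ∀ u, 0 < u → HasDerivAt (fun u => sinh (b * u) / sinh (a * u))
        ((b * cosh (b * u) * sinh (a * u) - sinh (b * u) * (a * cosh (a * u)))
          / sinh (a * u) ^ 2) u := fun u hu =>
      (hasDerivAt_sinh_mul b u).div (hasDerivAt_sinh_mul a u) (hsp a u ha hu).ne'
    refine strictMonoOn_of_deriv_pos (convex_Ioi 0)
      (fun u hu => (hd u hu).continuousAt.continuousWithinAt) (fun u hu => ?_)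
    rw [interior_Ioi] at hu
    rw [(hd u hu).deriv]
    have := key u hu
    have := hsp a u ha hu
    apply div_pos _ (by positivity)
    linarith
  have h := hmono hs (hs.trans hst) hst
  simp only at h
  rw [div_lt_div_iff₀ (hsp a s ha hs) (hsp a t ha (hs.trans hst))] at h
  linarith

theorem singleCrossing_sinh_sub_sinh {a b α β : ℝ} (hα : 0 < α) (hαβ : α < β) (hb : 0 < b) :
    SingleCrossing fun u => a * sinh (α * u) - b * sinh (β * u) := by
  intro s t hs hst h
  have h1 := sinh_mul_sinh_mul_lt hα hαβ hs hst
  have h2 : 0 < sinh (α * s) := sinh_pos_iff.2 (by positivity)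
  have h3 : 0 < sinh (α * t) := sinh_pos_iff.2 (by have := hs.trans hst; positivity)
  have h4 : (a * sinh (α * t) - b * sinh (β * t)) * sinh (α * s) < 0 := by
    have := mul_le_mul_of_nonneg_right h h3.le
    nlinarith
  exact neg_of_mul_neg_left h4 h2.le

/-- A linear combination of four hyperbolic sines with prescribed frequencies. -/
noncomputable def sinhComb (a α b β c γ d δ u : ℝ) : ℝ :=
  a * sinh (α * u) + b * sinh (β * u) + c * sinh (γ * u) + d * sinh (δ * u)

/-- Choosing l equal to one of the frequencies makes its coefficient vanish, so each use shortens
the sum by one term. The price is a check of the slope at 0. -/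
theorem singleCrossing_sinhComb {a α b β c γ d δ : ℝ} (l : ℝ)
    (h1 : 0 ≤ a * α + b * β + c * γ + d * δ)
    (hsc : SingleCrossing (sinhComb (a * (α ^ 2 - l ^ 2)) α (b * (β ^ 2 - l ^ 2)) β
      (c * (γ ^ 2 - l ^ 2)) γ (d * (δ ^ 2 - l ^ 2)) δ)) :
    SingleCrossing (sinhComb a α b β c γ d δ) := by
  refine SingleCrossing.of_second_order
    (w₁ := fun u => a * (α * cosh (α * u)) + b * (β * cosh (β * u)) + c * (γ * cosh (γ * u))
      + d * (δ * cosh (δ * u)))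
    (w₂ := fun u => a * (α * (α * sinh (α * u))) + b * (β * (β * sinh (β * u)))
      + c * (γ * (γ * sinh (γ * u))) + d * (δ * (δ * sinh (δ * u)))) l
    (fun u => ?_) (fun u => ?_) (by simp [sinhComb]) (by simpa using h1) ?_
  · exact ((((hasDerivAt_sinh_mul α u).const_mul a).add
      ((hasDerivAt_sinh_mul β u).const_mul b)).add
      ((hasDerivAt_sinh_mul γ u).const_mul c)).add ((hasDerivAt_sinh_mul δ u).const_mul d)
  · exact (((((hasDerivAt_cosh_mul α u).const_mul α).const_mul a).add
      (((hasDerivAt_cosh_mul β u).const_mul β).const_mul b)).add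
      (((hasDerivAt_cosh_mul γ u).const_mul γ).const_mul c)).add
      (((hasDerivAt_cosh_mul δ u).const_mul δ).const_mul d)
  · convert hsc using 2 with u
    simp only [sinhComb]
    ring

/-! ### Single crossing of the hyperbolic polynomial. -/

/-- The hyperbolic polynomial whose sign governs the second logarithmic derivative of the
pointwise deficit. -/
noncomputable def deficitPoly (p : ℝ) : ℝ → ℝ :=
  sinhComb 1 (3 * p - 2) (-(p - 1) ^ 2) (p + 2) (2 * (p - 2)) p (p ^ 2 - 2) (p - 2)

theorem singleCrossing_deficitPoly {p : ℝ} (h0 : p ≠ 0) (h1 : p ≠ 1) (h2 : p ≠ 2) :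
    SingleCrossing fun u => p * (2 - p) * deficitPoly p u := by
  have hp1 : 0 < (p - 1) ^ 2 := by have := sub_ne_zero.2 h1; positivity
  have e : (fun u => p * (2 - p) * deficitPoly p u) =
      sinhComb (p * (2 - p)) (3 * p - 2) (-(p * (2 - p) * (p - 1) ^ 2)) (p + 2)
        (p * (2 - p) * (2 * (p - 2))) p (p * (2 - p) * (p ^ 2 - 2)) (p - 2) := by
    funext u
    simp only [deficitPoly, sinhComb]
    ring
  rw [e]
  -- The slope of the sum at 0 is zero, so after one elimination the slope at 0 is the third
  -- derivative of the original sum, which is this square.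
  have third : 0 ≤ 8 * (p * (2 - p) * (p - 1)) ^ 2 := by positivity
  rcases lt_or_gt_of_ne h0 with hneg | hpos
  -- For p < 0 one elimination suffices: the remaining three terms have a positive sum, so the
  -- crossing condition holds vacuously.
  · refine singleCrossing_sinhComb (p - 2) (le_of_eq (by ring)) ?_
    intro s t hs hst hle
    exfalso
    refine hle.not_gt ?_
    have hsinh : ∀ u, 0 < u → (p - 1) * sinh (-((p + 2) * u)) < sinh (-((3 * p - 2) * u)) := by
      intro u hu
      have := pos_of_deriv_pos
        (h := fun u => sinh (-((3 * p - 2)) * u) - (p - 1) * sinh (-((p + 2)) * u))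
        (h' := fun u => -((3 * p - 2)) * cosh (-((3 * p - 2)) * u)
          - (p - 1) * (-((p + 2)) * cosh (-((p + 2)) * u)))
        (fun v => (hasDerivAt_sinh_mul _ v).sub ((hasDerivAt_sinh_mul _ v).const_mul _))
        (by simp) (fun v hv => ?_) hu
      · simp only [neg_mul] at this ⊢
        linarith
      · have hc : cosh (-((p + 2)) * v) ≤ cosh (-((3 * p - 2)) * v) := by
          rw [cosh_le_cosh, abs_mul, abs_mul, abs_neg, abs_neg]
          refine mul_le_mul_of_nonneg_right ?_ (abs_nonneg _)
          rw [abs_of_neg (by linarith : 3 * p - 2 < 0), abs_le]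
          constructor <;> linarith
        have hc0 := cosh_pos (-((p + 2)) * v)
        nlinarith [mul_pos hc0 (sq_pos_of_neg hneg), mul_pos hc0 (neg_pos.2 hneg)]
    have k1 := hsinh s hs
    have k2 : sinh (p * s) < 0 := sinh_neg_iff.2 (mul_neg_of_neg_of_pos hneg hs)
    simp only [sinh_neg] at k1
    have : sinhComb (p * (2 - p) * ((3 * p - 2) ^ 2 - (p - 2) ^ 2)) (3 * p - 2)
        (-(p * (2 - p) * (p - 1) ^ 2) * ((p + 2) ^ 2 - (p - 2) ^ 2)) (p + 2)
        (p * (2 - p) * (2 * (p - 2)) * (p ^ 2 - (p - 2) ^ 2)) p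
        (p * (2 - p) * (p ^ 2 - 2) * ((p - 2) ^ 2 - (p - 2) ^ 2)) (p - 2) s
        = 8 * (p * (2 - p) * (p - 1)) * (p * (sinh ((3 * p - 2) * s)
          - (p - 1) * sinh ((p + 2) * s)) + (p - 2) * sinh (p * s)) := by
      simp only [sinhComb]
      ring
    rw [this]
    have a1 : 0 < p * (2 - p) * (p - 1) :=
      mul_pos_of_neg_of_neg (mul_neg_of_neg_of_pos hneg (by linarith)) (by linarith)
    have a2 : 0 < p * (sinh ((3 * p - 2) * s) - (p - 1) * sinh ((p + 2) * s)) :=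
      mul_pos_of_neg_of_neg hneg (by linarith)
    have a3 : 0 < (p - 2) * sinh (p * s) := mul_pos_of_neg_of_neg (by linarith) k2
    positivity
  -- For p > 0, removing the frequency p and then one more leaves two terms, with the negative
  -- coefficient on the larger frequency. The second frequency removed is 3p - 2 for p < 1 and p - 2
  -- for p > 1.
  refine singleCrossing_sinhComb p (le_of_eq (by ring)) ?_
  rcases lt_or_gt_of_ne h1 with hlt | hgt
  · refine singleCrossing_sinhComb (3 * p - 2) (third.trans_eq (by ring)) ?_
    have hκ : 0 < p * (2 - p) := mul_pos hpos (by linarith)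
    convert singleCrossing_sinh_sub_sinh
      (a := p * (2 - p) * (2 - p ^ 2) * (4 - 4 * p) * (2 * p * (4 - 4 * p)))
      (b := p * (2 - p) * (p - 1) ^ 2 * (4 * p + 4) * ((4 - 2 * p) * (4 * p)))
      (by linarith : 0 < 2 - p) (by linarith : 2 - p < p + 2) ?_ using 2 with u
    · have : sinh ((p - 2) * u) = -sinh ((2 - p) * u) := by rw [← sinh_neg]; ring_nf
      simp only [sinhComb, this]
      ring
    · have : 0 < 4 - 2 * p := by linarith
      positivity
  · refine singleCrossing_sinhComb (p - 2) (third.trans_eq (by ring)) ?_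
    have hq : 0 < p - 1 := by linarith
    rcases lt_or_gt_of_ne h2 with hlt2 | hgt2
    · have hκ : 0 < p * (2 - p) := mul_pos hpos (by linarith)
      convert singleCrossing_sinh_sub_sinh
        (a := p * (2 - p) * ((3 * p - 2) ^ 2 - p ^ 2) * ((3 * p - 2) ^ 2 - (p - 2) ^ 2))
        (b := p * (2 - p) * (p - 1) ^ 2 * (4 * p + 4) * (8 * p))
        (by linarith : 0 < 3 * p - 2) (by linarith : 3 * p - 2 < p + 2) (by positivity)
        using 2 with u
      simp only [sinhComb]
      ring
    · have hκ : 0 < p * (p - 2) := mul_pos hpos (by linarith)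
      convert singleCrossing_sinh_sub_sinh
        (a := p * (p - 2) * (p - 1) ^ 2 * (4 * p + 4) * (8 * p))
        (b := p * (p - 2) * ((p - 1) * (8 * p - 4)) * (8 * p * (p - 1)))
        (by linarith : 0 < p + 2) (by linarith : p + 2 < 3 * p - 2) ?_ using 2 with u
      · simp only [sinhComb]
        ring
      · have : 0 < 8 * p - 4 := by linarith
        positivity

/-- The left side is the numerator of the derivative of the logarithmic ratio in
`singleCrossing_logRatio`. Both sides are rational in e^u and e^(pu), which reduces the identity to
algebra. -/
theorem sinh_combination_deriv_eq_deficitPoly (p u : ℝ) :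
    (p - 1) * ((p + 1) * cosh ((p + 1) * u) - cosh ((p - 1) * u))
        * sinh ((p - 1) * u) * cosh (p * u)
      - ((p - 1) * sinh ((p + 1) * u) - sinh ((p - 1) * u))
        * ((p - 1) * cosh ((p - 1) * u)) * cosh (p * u)
      - 2 * sinh (p * u) * ((p - 1) * sinh ((p + 1) * u) - sinh ((p - 1) * u))
        * sinh ((p - 1) * u) = deficitPoly p u / 2 := by
  have e1 : exp ((p + 1) * u) = exp (p * u) * exp u := by rw [← exp_add]; ring_nf
  have e2 : exp ((p - 1) * u) = exp (p * u) / exp u := by rw [← exp_sub]; ring_nf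
  have e3 : exp ((3 * p - 2) * u) = exp (p * u) ^ 3 / exp u ^ 2 := by
    rw [← exp_nat_mul, ← exp_nat_mul, ← exp_sub]; push_cast; ring_nf
  have e4 : exp ((p + 2) * u) = exp (p * u) * exp u ^ 2 := by
    rw [← exp_nat_mul, ← exp_add]; push_cast; ring_nf
  have e5 : exp ((p - 2) * u) = exp (p * u) / exp u ^ 2 := by
    rw [← exp_nat_mul, ← exp_sub]; push_cast; ring_nf
  simp only [deficitPoly, sinhComb, sinh_eq, cosh_eq, exp_neg, e1, e2, e3, e4, e5]
  have := (exp_pos u).ne'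
  have := (exp_pos (p * u)).ne'
  field_simp
  ring

theorem sinh_combination_sign {p u : ℝ} (h0 : p ≠ 0) (h1 : p ≠ 1) (hu : 0 < u) :
    0 < p * (p - 1) * ((p - 1) * sinh ((p + 1) * u) - sinh ((p - 1) * u)) := by
  have hp1 : 0 < (p - 1) ^ 2 := by have := sub_ne_zero.2 h1; positivity
  refine pos_of_deriv_pos
    (h := fun u => p * (p - 1) * ((p - 1) * sinh ((p + 1) * u) - sinh ((p - 1) * u)))
    (h' := fun u => p * (p - 1) * ((p - 1) * ((p + 1) * cosh ((p + 1) * u))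
      - (p - 1) * cosh ((p - 1) * u)))
    (fun v => (((hasDerivAt_sinh_mul _ v).const_mul _).sub (hasDerivAt_sinh_mul _ v)).const_mul _)
    (by simp) (fun v hv => ?_) hu
  have key : 0 < p * ((p + 1) * cosh ((p + 1) * v) - cosh ((p - 1) * v)) := by
    have c1 := cosh_pos ((p + 1) * v)
    have c2 := cosh_pos ((p - 1) * v)
    rcases lt_or_gt_of_ne h0 with hneg | hpos
    · have hc : cosh ((p + 1) * v) ≤ cosh ((p - 1) * v) := by
        rw [cosh_le_cosh, abs_mul, abs_mul]
        refine mul_le_mul_of_nonneg_right ?_ (abs_nonneg _)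
        rw [abs_of_neg (by linarith : p - 1 < 0), abs_le]
        constructor <;> linarith
      refine mul_pos_of_neg_of_neg hneg ?_
      nlinarith
    · have hc : cosh ((p - 1) * v) ≤ cosh ((p + 1) * v) := by
        rw [cosh_le_cosh, abs_mul, abs_mul]
        refine mul_le_mul_of_nonneg_right ?_ (abs_nonneg _)
        rw [abs_of_pos (by linarith : 0 < p + 1), abs_le]
        constructor <;> linarith
      refine mul_pos hpos ?_
      nlinarith
  calc (0 : ℝ) < (p - 1) ^ 2 * (p * ((p + 1) * cosh ((p + 1) * v) - cosh ((p - 1) * v))) :=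
        mul_pos hp1 key
    _ = _ := by ring

theorem sub_one_mul_sinh_pos {p u : ℝ} (h1 : p ≠ 1) (hu : 0 < u) :
    0 < (p - 1) * sinh ((p - 1) * u) := by
  rcases lt_or_gt_of_ne h1 with h | h
  · exact mul_pos_of_neg_of_neg (by linarith)
      (sinh_neg_iff.2 (mul_neg_of_neg_of_pos (by linarith) hu))
  · exact mul_pos (by linarith) (sinh_pos_iff.2 (mul_pos (by linarith) hu))

theorem hasDerivAt_log_cosh_mul (a u : ℝ) :
    HasDerivAt (fun v => log (cosh (a * v))) (a * (sinh (a * u) / cosh (a * u))) u := by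
  refine ((hasDerivAt_cosh_mul a u).log (cosh_pos _).ne').congr_deriv ?_
  ring

/-- The function tends to 0 at the origin, and its derivative is a positive multiple of p(2-p) times
`deficitPoly p`. -/
theorem singleCrossing_logRatio {p : ℝ} (h0 : p ≠ 0) (h1 : p ≠ 1) (h2 : p ≠ 2) :
    SingleCrossing fun u => (2 - p) * (log (((p - 1) * sinh ((p + 1) * u) - sinh ((p - 1) * u))
      / (p * sinh ((p - 1) * u))) - 2 / p * log (cosh (p * u))) := by
  have hX : ∀ u, HasDerivAt (fun u => (p - 1) * sinh ((p + 1) * u) - sinh ((p - 1) * u))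
      ((p - 1) * ((p + 1) * cosh ((p + 1) * u) - cosh ((p - 1) * u))) u := fun u =>
    (((hasDerivAt_sinh_mul (p + 1) u).const_mul (p - 1)).sub
      (hasDerivAt_sinh_mul (p - 1) u)).congr_deriv (by ring)
  have hp1 : p - 1 ≠ 0 := sub_ne_zero.2 h1
  refine SingleCrossing.of_deriv (l := 0) (h' := fun u => (2 - p) *
    (((p - 1) * ((p + 1) * cosh ((p + 1) * u) - cosh ((p - 1) * u)))
      / ((p - 1) * sinh ((p + 1) * u) - sinh ((p - 1) * u))
      - (p - 1) * cosh ((p - 1) * u) / sinh ((p - 1) * u)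
      - 2 * (sinh (p * u) / cosh (p * u)))) (fun u hu => ?_) ?_ le_rfl ?_
  · have n1 := right_ne_zero_of_mul (sinh_combination_sign h0 h1 hu).ne'
    have n2 := right_ne_zero_of_mul (sub_one_mul_sinh_pos h1 hu).ne'
    refine (((((hX u).div ((hasDerivAt_sinh_mul (p - 1) u).const_mul p)
      (mul_ne_zero h0 n2)).log (div_ne_zero n1 (mul_ne_zero h0 n2))).sub
      ((hasDerivAt_log_cosh_mul p u).const_mul (2 / p))).const_mul (2 - p)).congr_deriv ?_
    have n3 := (cosh_pos (p * u)).ne'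
    simp only [Pi.div_apply]
    field_simp
  -- Numerator and denominator of the ratio both vanish at 0 with slope p(p-1), so the ratio tends
  -- to 1.
  · have t1 : Tendsto (fun u => u⁻¹ * ((p - 1) * sinh ((p + 1) * u) - sinh ((p - 1) * u)))
        (𝓝[>] 0) (𝓝 ((p - 1) * p)) := by
      have := ((hX 0).tendsto_slope_zero_right)
      simpa using this
    have t2 : Tendsto (fun u => u⁻¹ * (p * sinh ((p - 1) * u)))
        (𝓝[>] 0) (𝓝 (p * (p - 1))) := by
      have := (((hasDerivAt_sinh_mul (p - 1) 0).const_mul p).tendsto_slope_zero_right)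
      simpa using this
    have t3 : Tendsto (fun u => log (((p - 1) * sinh ((p + 1) * u) - sinh ((p - 1) * u))
        / (p * sinh ((p - 1) * u)))) (𝓝[>] 0) (𝓝 (log 1)) := by
      refine Tendsto.log ?_ one_ne_zero
      have := t1.div t2 (mul_ne_zero h0 hp1)
      rw [mul_comm p, div_self (mul_ne_zero hp1 h0)] at this
      refine this.congr' ?_
      filter_upwards [self_mem_nhdsWithin] with u hu
      have hu' : u⁻¹ ≠ 0 := inv_ne_zero (ne_of_gt hu)
      simp only [Pi.div_apply]
      rw [mul_div_mul_left _ _ hu']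
    have t4 : Tendsto (fun u => 2 / p * log (cosh (p * u))) (𝓝[>] 0) (𝓝 0) := by
      have := (((hasDerivAt_log_cosh_mul p 0).const_mul (2 / p)).continuousAt.tendsto).mono_left
        (nhdsWithin_le_nhds (s := Set.Ioi 0))
      simpa using this
    simpa using (t3.sub t4).const_mul (2 - p)
  · refine (singleCrossing_deficitPoly h0 h1 h2).mul_pos
      (m := fun u => (p - 1) ^ 2 / (2 * (p * (p - 1)
        * ((p - 1) * sinh ((p + 1) * u) - sinh ((p - 1) * u)))
        * ((p - 1) * sinh ((p - 1) * u)) * cosh (p * u))) (fun u hu => ?_) (fun u hu => ?_)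
    · have n1 := sinh_combination_sign h0 h1 hu
      have n2 := sub_one_mul_sinh_pos h1 hu
      have n3 := cosh_pos (p * u)
      positivity
    · have n1 := right_ne_zero_of_mul (sinh_combination_sign h0 h1 hu).ne'
      have n2 := right_ne_zero_of_mul (sub_one_mul_sinh_pos h1 hu).ne'
      have n3 := (cosh_pos (p * u)).ne'
      have key := sinh_combination_deriv_eq_deficitPoly p u
      have : deficitPoly p u = 2 * (deficitPoly p u / 2) := by ring
      rw [this, ← key]
      generalize (p - 1) * sinh ((p + 1) * u) - sinh ((p - 1) * u) = X at *
      field_simp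

/-! ### The pointwise deficit and its sign. -/

/-- The logarithm of `(x + y)^p / ((1 + t^(2q/p))^(p-1) (x^p + y^p))`, where
`t = 2 (x y)^(p/2) / (x^p + y^p)`, as a function of `u = log (x / y) / 2`. -/
noncomputable def logDeficit (p q u : ℝ) : ℝ :=
  p * log (cosh u) - log (cosh (p * u)) + (p - 1) * log 2
    - (p - 1) * log (1 + exp (-(2 * q / p) * log (cosh (p * u))))

/-- The derivative of `logDeficit p q`. -/
noncomputable def logDeficitDeriv (p q u : ℝ) : ℝ :=
  p * (sinh u / cosh u) - p * (sinh (p * u) / cosh (p * u))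
    + 2 * q * (p - 1) * (sinh (p * u) / cosh (p * u)
      * (exp (-(2 * q / p) * log (cosh (p * u)))
        / (1 + exp (-(2 * q / p) * log (cosh (p * u))))))

theorem hasDerivAt_logDeficit {p : ℝ} (h0 : p ≠ 0) (q u : ℝ) :
    HasDerivAt (logDeficit p q) (logDeficitDeriv p q u) u := by
  have hl := hasDerivAt_log_cosh_mul p u
  have h1 : HasDerivAt (fun u => log (cosh u)) (sinh u / cosh u) u :=
    (hasDerivAt_cosh u).log (cosh_pos u).ne'
  have h3 : 1 + exp (-(2 * q / p) * log (cosh (p * u))) ≠ 0 := by positivity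
  have h2 := (((hl.const_mul (-(2 * q / p))).exp.const_add 1).log h3).const_mul (p - 1)
  refine ((((h1.const_mul p).sub hl).add_const ((p - 1) * log 2)).sub h2).congr_deriv ?_
  rw [logDeficitDeriv]
  generalize exp (-(2 * q / p) * log (cosh (p * u))) = g at *
  have n3 := (cosh_pos (p * u)).ne'
  have n4 := (cosh_pos u).ne'
  field_simp
  ring

theorem logDeficit_zero (p q : ℝ) : logDeficit p q 0 = 0 := by
  norm_num [logDeficit]

theorem logDeficit_neg (p q u : ℝ) : logDeficit p q (-u) = logDeficit p q u := by
  simp [logDeficit]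

/-- By the addition formulas the derivative is an explicit factor times e^z - 1, with z the
logarithmic ratio of `singleCrossing_logRatio`. Since e^z - 1 and z have the same sign, the crossing
property transfers. -/
theorem singleCrossing_logDeficitDeriv {p : ℝ} (h0 : p ≠ 0) (h1 : p ≠ 1) (h2 : p ≠ 2) :
    SingleCrossing fun u => p * (p - 1) * (2 - p) * logDeficitDeriv p 1 u := by
  have hexp : SingleCrossing fun u => (2 - p) *
      (exp (log (((p - 1) * sinh ((p + 1) * u) - sinh ((p - 1) * u))
      / (p * sinh ((p - 1) * u))) - 2 / p * log (cosh (p * u))) - 1) := by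
    refine (singleCrossing_logRatio h0 h1 h2).congr_sign (fun u _ hu => ?_) (fun u _ hu => ?_)
    · rcases lt_or_gt_of_ne h2 with h | h
      · have : 0 < 2 - p := by linarith
        have := nonpos_of_mul_nonpos_right hu this
        refine mul_nonpos_of_nonneg_of_nonpos (by linarith) ?_
        rw [← exp_le_one_iff]
        linarith
      · have h' : 2 - p < 0 := by linarith
        have := nonneg_of_mul_nonpos_right hu h'
        refine mul_nonpos_of_nonpos_of_nonneg (by linarith) ?_
        rw [← one_le_exp_iff]
        linarith
    · rcases lt_or_gt_of_ne h2 with h | h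
      · have : 0 < 2 - p := by linarith
        have := neg_of_mul_neg_right hu this.le
        refine mul_neg_of_pos_of_neg (by linarith) ?_
        rw [← exp_lt_one_iff] at this
        linarith
      · have h' : 2 - p < 0 := by linarith
        have := pos_of_mul_neg_right hu h'.le
        refine mul_neg_of_neg_of_pos (by linarith) ?_
        rw [← one_lt_exp_iff] at this
        linarith
  refine hexp.mul_pos (m := fun u => p ^ 2 * ((p - 1) * sinh ((p - 1) * u))
      / (cosh u * cosh (p * u) * (1 + exp (-(2 / p * log (cosh (p * u)))))))
    (fun u hu => ?_) (fun u hu => ?_)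
  · have := sub_one_mul_sinh_pos h1 hu
    have := cosh_pos u
    have := cosh_pos (p * u)
    positivity
  · have n1 := sinh_combination_sign h0 h1 hu
    have n2 := sub_one_mul_sinh_pos h1 hu
    have hr : 0 < ((p - 1) * sinh ((p + 1) * u) - sinh ((p - 1) * u))
        / (p * sinh ((p - 1) * u)) := by
      have : ((p - 1) * sinh ((p + 1) * u) - sinh ((p - 1) * u)) / (p * sinh ((p - 1) * u))
          = (p * (p - 1) * ((p - 1) * sinh ((p + 1) * u) - sinh ((p - 1) * u)))
            / (p ^ 2 * ((p - 1) * sinh ((p - 1) * u))) := by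
        have := right_ne_zero_of_mul n2.ne'
        have := sub_ne_zero.2 h1
        field_simp
      rw [this]
      positivity
    rw [sub_eq_add_neg (log _), exp_add, exp_log hr, logDeficitDeriv]
    simp only [mul_one, neg_mul]
    have hg : 0 < exp (-(2 / p * log (cosh (p * u)))) := exp_pos _
    generalize exp (-(2 / p * log (cosh (p * u)))) = g at *
    have m1 : sinh ((p - 1) * u) = sinh (p * u) * cosh u - cosh (p * u) * sinh u := by
      rw [← sinh_sub]; ring_nf
    have m2 : sinh ((p + 1) * u) = sinh (p * u) * cosh u + cosh (p * u) * sinh u := by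
      rw [← sinh_add]; ring_nf
    have n2' := right_ne_zero_of_mul n2.ne'
    rw [m2]
    generalize sinh ((p - 1) * u) = Y at *
    have n3 := (cosh_pos (p * u)).ne'
    have n4 := (cosh_pos u).ne'
    have n5 : 1 + g ≠ 0 := by positivity
    field_simp
    rw [m1]
    ring

theorem log_cosh_eq (v : ℝ) : log (cosh v) = v - log 2 + log (1 + exp (-(2 * v))) := by
  have : cosh v = exp v / 2 * (1 + exp (-(2 * v))) := by
    rw [cosh_eq, mul_add, div_mul_eq_mul_div, div_mul_eq_mul_div, ← exp_add]
    ring_nf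
  rw [this, log_mul (by positivity) (by positivity), log_div (by positivity) (by positivity),
    log_exp]

theorem tendsto_log_one_add_exp_neg {f : ℝ → ℝ} (hf : Tendsto f atTop atTop) :
    Tendsto (fun u => log (1 + exp (-f u))) atTop (𝓝 0) := by
  have h1 : Tendsto (fun u => 1 + exp (-f u)) atTop (𝓝 (1 + 0)) :=
    (tendsto_exp_neg_atTop_nhds_zero.comp hf).const_add 1
  simpa using h1.log (by norm_num)

/-- By `log_cosh_eq` the linear terms and the multiples of log 2 cancel exactly, and only vanishing
logarithms remain. -/
theorem tendsto_logDeficit_of_pos {p : ℝ} (h0 : 0 < p) :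
    Tendsto (logDeficit p 1) atTop (𝓝 0) := by
  have e : logDeficit p 1 = fun u => p * log (1 + exp (-(2 * u))) - log (1 + exp (-(2 * (p * u))))
      - (p - 1) * log (1 + exp (-(2 / p * log (cosh (p * u))))) := by
    funext u
    rw [logDeficit, log_cosh_eq u]
    simp only [mul_one, neg_mul]
    generalize log (1 + exp (-(2 / p * log (cosh (p * u))))) = z
    rw [log_cosh_eq (p * u)]
    ring
  have hp : Tendsto (fun u => p * u) atTop atTop := tendsto_id.const_mul_atTop h0
  have hc : Tendsto (fun u => log (cosh (p * u))) atTop atTop := by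
    refine tendsto_atTop_mono (f := fun u => p * u + -log 2) (fun u => ?_)
      (tendsto_atTop_add_const_right _ _ hp)
    rw [log_cosh_eq]
    have : 0 ≤ log (1 + exp (-(2 * (p * u)))) := log_nonneg (by linarith [exp_pos (-(2 * (p * u)))])
    linarith
  rw [e]
  simpa using (((tendsto_log_one_add_exp_neg (tendsto_id.const_mul_atTop two_pos)).const_mul p).sub
    (tendsto_log_one_add_exp_neg (hp.const_mul_atTop two_pos))).sub
    ((tendsto_log_one_add_exp_neg (hc.const_mul_atTop (by positivity : 0 < 2 / p))).const_mul
      (p - 1))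

theorem tendsto_logDeficit_of_neg {p : ℝ} (h0 : p < 0) :
    Tendsto (logDeficit p 1) atTop atTop := by
  have hb : ∀ᶠ u in atTop, 2 * u + (p - 1 - (p - 2) / p) * log 2 ≤ logDeficit p 1 u := by
    filter_upwards [eventually_ge_atTop 0] with u hu
    have hp0 := h0.ne
    have c1 : log (cosh u) ≤ u := by
      rw [log_le_iff_le_exp (cosh_pos u), cosh_eq]
      linarith [exp_le_exp.2 (by linarith : -u ≤ u)]
    have c2 : -(p * u) - log 2 ≤ log (cosh (p * u)) := by
      rw [← cosh_neg, log_cosh_eq]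
      have : 0 ≤ log (1 + exp (-(2 * -(p * u)))) :=
        log_nonneg (by linarith [exp_pos (-(2 * -(p * u)))])
      linarith
    have c3 : -(2 / p) * log (cosh (p * u))
        ≤ log (1 + exp (-(2 / p) * log (cosh (p * u)))) := by
      rw [le_log_iff_exp_le (by positivity)]
      linarith
    have d1 := mul_le_mul_of_nonpos_left c1 h0.le
    have d3 := mul_le_mul_of_nonpos_left c3 (by linarith : p - 1 ≤ 0)
    have d2 := mul_le_mul_of_nonneg_left c2
      (div_nonneg_of_nonpos (by linarith : p - 2 ≤ 0) h0.le)
    rw [logDeficit]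
    simp only [mul_one]
    -- Together with the term -log cosh(pu) of the deficit, the total coefficient of log cosh(pu) is
    -- (p-2)/p > 0. The lower bound for log cosh(pu) then gives growth at rate p - (p-2) = 2.
    have e1 : (p - 1) * (-(2 / p) * log (cosh (p * u)))
        = -log (cosh (p * u)) - (p - 2) / p * log (cosh (p * u)) := by
      field_simp
      ring
    have e2 : (p - 2) / p * (-(p * u) - log 2) = -(p - 2) * u - (p - 2) / p * log 2 := by
      field_simp
    rw [e1] at d3
    rw [e2] at d2
    linarith
  exact tendsto_atTop_mono' _ hb
    (tendsto_atTop_add_const_right _ _ (tendsto_id.const_mul_atTop two_pos))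

theorem logDeficit_sign {p u : ℝ} (h0 : p ≠ 0) (h1 : p ≠ 1) (h2 : p ≠ 2) (hu : u ≠ 0) :
    0 < p * (p - 1) * (2 - p) * logDeficit p 1 u := by
  wlog hpos : 0 < u generalizing u
  · have := this (neg_ne_zero.2 hu) (by
      have := lt_of_le_of_ne (not_lt.1 hpos) hu
      linarith)
    rwa [logDeficit_neg] at this
  refine pos_of_singleCrossing_deriv
    (h := fun u => p * (p - 1) * (2 - p) * logDeficit p 1 u) (l := 0)
    (fun v _ => (hasDerivAt_logDeficit h0 1 v).const_mul _) ?_ le_rfl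
    (singleCrossing_logDeficitDeriv h0 h1 h2) ?_ hpos
  · have := ((hasDerivAt_logDeficit h0 1 0).const_mul
      (p * (p - 1) * (2 - p))).continuousAt.tendsto.mono_left
      (nhdsWithin_le_nhds (s := Set.Ioi 0))
    simpa [logDeficit_zero] using this
  · intro δ hδ
    rcases lt_or_gt_of_ne h0 with h | h
    · have hc : 0 < p * (p - 1) * (2 - p) :=
        mul_pos (mul_pos_of_neg_of_neg h (by linarith)) (by linarith)
      exact ((tendsto_logDeficit_of_neg h).const_mul_atTop hc).eventually_gt_atTop _
    · have := (tendsto_logDeficit_of_pos h).const_mul (p * (p - 1) * (2 - p))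
      rw [mul_zero] at this
      exact this.eventually_const_lt (by linarith)

/-! ### Second-order behaviour at the diagonal. -/

theorem hasDerivAt_logDeficitDeriv_zero (p q : ℝ) :
    HasDerivAt (logDeficitDeriv p q) (p * (p - 1) * (q - 1)) 0 := by
  have ht : ∀ a : ℝ, HasDerivAt (fun u => sinh (a * u) / cosh (a * u)) a 0 := fun a =>
    ((hasDerivAt_sinh_mul a 0).div (hasDerivAt_cosh_mul a 0) (cosh_pos _).ne').congr_deriv
      (by simp)
  have h1 : HasDerivAt (fun u => sinh u / cosh u) 1 0 := by simpa using ht 1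
  have hg := ((hasDerivAt_log_cosh_mul p 0).const_mul (-(2 * q / p))).exp
  have hr := hg.div (hg.const_add 1) (by positivity)
  refine (((h1.const_mul p).sub ((ht p).const_mul p)).add
    (((ht p).mul hr).const_mul (2 * q * (p - 1)))).congr_deriv ?_
  simp
  ring

theorem exists_pos_of_second_deriv_pos {h h' : ℝ → ℝ} {c : ℝ}
    (hd : ∀ u, HasDerivAt h (h' u) u) (h0 : h 0 = 0) (h0' : h' 0 = 0)
    (hc : HasDerivAt h' c 0) (hpos : 0 < c) : ∃ u, 0 < h u := by
  have h1 := hc.tendsto_slope_zero_right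
  simp only [zero_add, h0', sub_zero, smul_eq_mul] at h1
  have h2 := h1.eventually_const_lt hpos
  obtain ⟨δ, hδ, hδ'⟩ := mem_nhdsGT_iff_exists_Ioo_subset.1 h2
  have hδ0 : 0 < δ := hδ
  refine ⟨δ / 2, ?_⟩
  have hmono : StrictMonoOn h (Set.Icc 0 (δ / 2)) := by
    refine strictMonoOn_of_deriv_pos (convex_Icc _ _)
      (fun u _ => (hd u).continuousAt.continuousWithinAt) (fun u hu => ?_)
    rw [interior_Icc] at hu
    rw [(hd u).deriv]
    have h3 : 0 < u⁻¹ * h' u := hδ' ⟨hu.1, by linarith [hu.2]⟩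
    exact pos_of_mul_pos_right h3 (inv_nonneg.2 hu.1.le)
  simpa [h0] using hmono ⟨le_rfl, by linarith⟩ ⟨by linarith, le_rfl⟩ (by linarith : 0 < δ / 2)

theorem exists_logDeficit_pos {p q : ℝ} (h : 0 < p * (p - 1) * (q - 1)) :
    ∃ u, 0 < logDeficit p q u := by
  have h0 : p ≠ 0 := by rintro rfl; simp at h
  exact exists_pos_of_second_deriv_pos (hasDerivAt_logDeficit h0 q) (logDeficit_zero p q)
    (by simp [logDeficitDeriv]) (hasDerivAt_logDeficitDeriv_zero p q) h

theorem exists_logDeficit_neg {p q : ℝ} (h : p * (p - 1) * (q - 1) < 0) :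
    ∃ u, logDeficit p q u < 0 := by
  have h0 : p ≠ 0 := by rintro rfl; simp at h
  obtain ⟨u, hu⟩ := exists_pos_of_second_deriv_pos (h := fun u => -logDeficit p q u)
    (fun u => (hasDerivAt_logDeficit h0 q u).neg) (by simp [logDeficit_zero])
    (by simp [logDeficitDeriv]) (hasDerivAt_logDeficitDeriv_zero p q).neg (neg_pos.2 h)
  exact ⟨u, neg_pos.1 hu⟩

/-! ### Concavity and convexity of the overlap bound. -/

/-- The power function `(1 + t^(2/p))^(p-1)` of the normalized overlap `t ∈ [0, 1]`. -/
noncomputable def overlapBound (p t : ℝ) : ℝ := (1 + t ^ (2 / p)) ^ (p - 1)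

/-- The derivative of `overlapBound p` on `(0, ∞)`. -/
noncomputable def overlapBoundDeriv (p t : ℝ) : ℝ :=
  (p - 1) * (2 / p) * (t ^ (2 / p) + (t ^ (2 / p))⁻¹ + 2) ^ ((p - 2) / 2)

theorem hasDerivAt_overlapBound {p t : ℝ} (h0 : p ≠ 0) (ht : 0 < t) :
    HasDerivAt (overlapBound p) (overlapBoundDeriv p t) t := by
  have hw : 0 < t ^ (2 / p) := rpow_pos_of_pos ht _
  refine (((hasDerivAt_rpow_const (p := 2 / p) (Or.inl ht.ne')).const_add 1).rpow_const
    (p := p - 1) (Or.inl (by positivity))).congr_deriv ?_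
  -- With w = t^(2/p) this is w + 1/w + 2 = (1+w)²/w, whose power (p-2)/2 collects the two factors
  -- given by the chain rule.
  have e1 : t ^ (2 / p) + (t ^ (2 / p))⁻¹ + 2 = (1 + t ^ (2 / p)) ^ (2 : ℝ) * t ^ (-(2 / p)) := by
    rw [rpow_neg ht.le, rpow_two]
    field_simp
    ring
  rw [overlapBoundDeriv, e1, mul_rpow (by positivity) (by positivity), ← rpow_mul (by positivity),
    ← rpow_mul ht.le]
  have e2 : -(2 / p) * ((p - 2) / 2) = 2 / p - 1 := by field_simp; ring
  have e3 : 2 * ((p - 2) / 2) = p - 1 - 1 := by ring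
  rw [e2, e3]
  ring

/-- The expression w + 1/w with w = t^(2/p) is unchanged under w ↦ 1/w, so it decreases on (0,1]
whatever the sign of p. The sign of p - 2 then decides the monotonicity of the power, and the
prefactor supplies the rest. -/
theorem overlapBoundDeriv_strictAnti {p ε s t : ℝ} (hε : 0 < ε * (p * (p - 1) * (p - 2)))
    (hs : 0 < s) (hst : s < t) (ht : t ≤ 1) :
    ε * overlapBoundDeriv p t < ε * overlapBoundDeriv p s := by
  have h0 : p ≠ 0 := by rintro rfl; simp at hε
  have ht0 := hs.trans hst
  have hk : t ^ (2 / p) + (t ^ (2 / p))⁻¹ + 2 < s ^ (2 / p) + (s ^ (2 / p))⁻¹ + 2 := by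
    have aux : ∀ v w : ℝ, 0 < v → v < w → w ≤ 1 → w + w⁻¹ < v + v⁻¹ := by
      intro v w hv hvw hw
      have hw0 := hv.trans hvw
      have : v + v⁻¹ - (w + w⁻¹) = (w - v) * (1 - v * w) / (v * w) := by
        field_simp
        ring
      have h1 : 0 < w - v := by linarith
      have h2 : 0 < 1 - v * w := by nlinarith
      have : 0 < v + v⁻¹ - (w + w⁻¹) := by rw [this]; positivity
      linarith
    rcases lt_or_gt_of_ne h0 with h | h
    · have h' : 0 < -(2 / p) := neg_pos.2 (div_neg_of_pos_of_neg two_pos h)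
      have := aux (s ^ (-(2 / p))) (t ^ (-(2 / p))) (rpow_pos_of_pos hs _)
        (rpow_lt_rpow hs.le hst h') (rpow_le_one ht0.le ht h'.le)
      rw [rpow_neg hs.le, rpow_neg ht0.le, inv_inv, inv_inv] at this
      linarith
    · have h' : 0 < 2 / p := by positivity
      have := aux (s ^ (2 / p)) (t ^ (2 / p)) (rpow_pos_of_pos hs _)
        (rpow_lt_rpow hs.le hst h') (rpow_le_one ht0.le ht h'.le)
      linarith
  have hkt : 0 < t ^ (2 / p) + (t ^ (2 / p))⁻¹ + 2 := by positivity
  have hc : 0 < (ε * ((p - 1) * (2 / p))) * (p - 2) := by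
    have : (ε * ((p - 1) * (2 / p))) * (p - 2) = ε * (p * (p - 1) * (p - 2)) * (2 / p ^ 2) := by
      field_simp
    rw [this]
    positivity
  have e : ∀ r, ε * overlapBoundDeriv p r = (ε * ((p - 1) * (2 / p)))
      * (r ^ (2 / p) + (r ^ (2 / p))⁻¹ + 2) ^ ((p - 2) / 2) := fun r => by
    rw [overlapBoundDeriv]; ring
  rw [e, e]
  rcases lt_trichotomy p 2 with h | h | h
  · have hc' : ε * ((p - 1) * (2 / p)) < 0 := neg_of_mul_pos_left hc (by linarith)
    exact mul_lt_mul_of_neg_left (rpow_lt_rpow_of_neg hkt hk (by linarith)) hc'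
  · simp [h] at hc
  · have hc' : 0 < ε * ((p - 1) * (2 / p)) := pos_of_mul_pos_left hc (by linarith)
    exact mul_lt_mul_of_pos_left (rpow_lt_rpow hkt.le hk (by linarith)) hc'

theorem continuousAt_overlapBound {p t : ℝ} (h0 : p ≠ 0) (ht : 0 ≤ t) (htp : t = 0 → 0 < p) :
    ContinuousAt (overlapBound p) t := by
  rcases ht.eq_or_lt with rfl | h
  · have hp := htp rfl
    refine ((continuousAt_rpow_const 0 (2 / p) (Or.inr (by positivity))).const_add 1).rpow_const
      (Or.inl ?_)
    have : (0 : ℝ) ≤ 0 ^ (2 / p) := by positivity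
    positivity
  · exact (hasDerivAt_overlapBound h0 h).continuousAt

/-- The gap between tangent and function vanishes at s and is strictly monotone on each side. The
endpoint t = 0, reached by continuity when p > 0, serves points where exactly one function vanishes.
-/
theorem overlapBound_tangent {p ε s t : ℝ} (hε : 0 < ε * (p * (p - 1) * (p - 2)))
    (hs : 0 < s) (hs1 : s ≤ 1) (ht : 0 ≤ t) (ht1 : t ≤ 1) (htp : t = 0 → 0 < p) (hne : t ≠ s) :
    0 < ε * (overlapBound p s + overlapBoundDeriv p s * (t - s) - overlapBound p t) := by
  have h0 : p ≠ 0 := by rintro rfl; simp at hε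
  set k : ℝ → ℝ := fun r =>
    ε * (overlapBound p s + overlapBoundDeriv p s * (r - s) - overlapBound p r) with hk
  have hks : k s = 0 := by simp [hk]
  have hd : ∀ r, 0 < r →
      HasDerivAt k (ε * overlapBoundDeriv p s - ε * overlapBoundDeriv p r) r := fun r hr => by
    refine ((((((hasDerivAt_id r).sub_const s).const_mul (overlapBoundDeriv p s)).const_add
      (overlapBound p s)).sub (hasDerivAt_overlapBound h0 hr)).const_mul ε).congr_deriv ?_
    ring
  have hcont : ∀ r, 0 ≤ r → (r = 0 → 0 < p) → ContinuousAt k r := fun r hr hrp =>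
    (ContinuousAt.sub (by fun_prop) (continuousAt_overlapBound h0 hr hrp)).const_mul ε
  change 0 < k t
  rcases lt_or_gt_of_ne hne with h | h
  · have hanti : StrictAntiOn k (Set.Icc t s) := by
      refine strictAntiOn_of_deriv_neg (convex_Icc _ _) (fun r hr =>
        (hcont r (ht.trans hr.1) fun h => htp (by linarith [hr.1])).continuousWithinAt)
        (fun r hr => ?_)
      rw [interior_Icc] at hr
      have hr0 := ht.trans_lt hr.1
      rw [(hd r hr0).deriv, sub_neg]
      exact overlapBoundDeriv_strictAnti hε hr0 hr.2 hs1
    rw [← hks]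
    exact hanti ⟨le_rfl, h.le⟩ ⟨h.le, le_rfl⟩ h
  · have hmono : StrictMonoOn k (Set.Icc s t) := by
      refine strictMonoOn_of_deriv_pos (convex_Icc _ _) (fun r hr =>
        (hd r (hs.trans_le hr.1)).continuousAt.continuousWithinAt) (fun r hr => ?_)
      rw [interior_Icc] at hr
      rw [(hd r (hs.trans hr.1)).deriv, sub_pos]
      exact overlapBoundDeriv_strictAnti hε hs hr.1 (hr.2.le.trans ht1)
    rw [← hks]
    exact hmono ⟨le_rfl, h.le⟩ ⟨h.le, le_rfl⟩ h

/-! ### The inequality for integrands. -/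

theorem two_cosh_rpow_eq (p q u : ℝ) :
    (2 * cosh u) ^ p = 2 * cosh (p * u) * (1 + cosh (p * u) ^ (-(2 * q / p))) ^ (p - 1)
      * exp (logDeficit p q u) := by
  have c1 := cosh_pos u
  have c2 := cosh_pos (p * u)
  have c3 : 0 < 1 + cosh (p * u) ^ (-(2 * q / p)) := by positivity
  have e : cosh (p * u) ^ (-(2 * q / p)) = exp (-(2 * q / p) * log (cosh (p * u))) := by
    rw [rpow_def_of_pos c2, mul_comm]
  rw [← exp_log (show 0 < (2 * cosh u) ^ p by positivity),
    ← exp_log (show 0 < 2 * cosh (p * u) * (1 + cosh (p * u) ^ (-(2 * q / p))) ^ (p - 1) by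
      positivity), ← exp_add, log_rpow (by positivity), log_mul two_ne_zero c1.ne',
    log_mul (by positivity) (by positivity), log_mul two_ne_zero c2.ne', log_rpow c3, logDeficit, e]
  ring_nf

theorem exp_symm_rpow (p v u : ℝ) :
    exp (v + u) ^ p + exp (v - u) ^ p = exp (p * v) * (2 * cosh (p * u)) ∧
    (exp (v + u) * exp (v - u)) ^ (p / 2) = exp (p * v) ∧
    (exp (v + u) + exp (v - u)) ^ p = exp (p * v) * (2 * cosh u) ^ p := by
  refine ⟨?_, ?_, ?_⟩
  · rw [← exp_mul, ← exp_mul, cosh_eq, mul_div_cancel₀ _ two_ne_zero, mul_add, ← exp_add,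
      ← exp_add]
    ring_nf
  · rw [← exp_add, ← exp_mul]
    ring_nf
  · have : exp (v + u) + exp (v - u) = exp v * (2 * cosh u) := by
      rw [cosh_eq, mul_div_cancel₀ _ two_ne_zero, mul_add, ← exp_add, ← exp_add]
      ring_nf
    have c1 := cosh_pos u
    rw [this, mul_rpow (by positivity) (by positivity), ← exp_mul, mul_comm v]

/-- In the variables x = e^(v+u), y = e^(v-u), and up to a positive factor, the expression is the
tangent gap at t = 1/cosh(pu) plus B(t) times ε(1 - exp(`logDeficit p 1 u`)). Both are nonnegative,
and the second is positive unless u = 0. -/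
theorem tangent_bound_of_pos {p ε s x y : ℝ} (hε : 0 < ε * (p * (p - 1) * (p - 2)))
    (hs : 0 < s) (hs1 : s ≤ 1) (hx : 0 < x) (hy : 0 < y) :
    0 ≤ ε * ((overlapBound p s - s * overlapBoundDeriv p s) * (x ^ p + y ^ p)
      + 2 * overlapBoundDeriv p s * (x * y) ^ (p / 2) - (x + y) ^ p) ∧
    (x ≠ y → 0 < ε * ((overlapBound p s - s * overlapBoundDeriv p s) * (x ^ p + y ^ p)
      + 2 * overlapBoundDeriv p s * (x * y) ^ (p / 2) - (x + y) ^ p)) := by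
  have h0 : p ≠ 0 := by rintro rfl; simp at hε
  have h1 : p ≠ 1 := by rintro rfl; simp at hε
  have h2 : p ≠ 2 := by rintro rfl; simp at hε
  obtain ⟨v, u, rfl, rfl⟩ : ∃ v u, x = exp (v + u) ∧ y = exp (v - u) := by
    refine ⟨(log x + log y) / 2, (log x - log y) / 2, ?_, ?_⟩
    · rw [show (log x + log y) / 2 + (log x - log y) / 2 = log x by ring, exp_log hx]
    · rw [show (log x + log y) / 2 - (log x - log y) / 2 = log y by ring, exp_log hy]
  obtain ⟨e1, e2, e3⟩ := exp_symm_rpow p v u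
  have c2 := cosh_pos (p * u)
  have ht1 : (cosh (p * u))⁻¹ ≤ 1 := inv_le_one_of_one_le₀ (one_le_cosh _)
  have ht0 : 0 < (cosh (p * u))⁻¹ := by positivity
  have hb : 0 < overlapBound p (cosh (p * u))⁻¹ := by
    unfold overlapBound
    positivity
  have e4 : (2 * cosh u) ^ p
      = 2 * cosh (p * u) * overlapBound p (cosh (p * u))⁻¹ * exp (logDeficit p 1 u) := by
    rw [two_cosh_rpow_eq p 1 u, overlapBound, inv_rpow c2.le, ← rpow_neg c2.le, mul_one]
  have e5 : ε * ((overlapBound p s - s * overlapBoundDeriv p s) * (exp (v + u) ^ p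
      + exp (v - u) ^ p) + 2 * overlapBoundDeriv p s * (exp (v + u) * exp (v - u)) ^ (p / 2)
      - (exp (v + u) + exp (v - u)) ^ p)
      = 2 * exp (p * v) * cosh (p * u) * (ε * (overlapBound p s
        + overlapBoundDeriv p s * ((cosh (p * u))⁻¹ - s) - overlapBound p (cosh (p * u))⁻¹)
        + overlapBound p (cosh (p * u))⁻¹ * (ε * (1 - exp (logDeficit p 1 u)))) := by
    rw [e1, e2, e3, e4]
    field_simp
    ring
  rw [e5]
  have htan : 0 ≤ ε * (overlapBound p s
        + overlapBoundDeriv p s * ((cosh (p * u))⁻¹ - s) - overlapBound p (cosh (p * u))⁻¹) := by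
    by_cases hts : (cosh (p * u))⁻¹ = s
    · simp [hts]
    · exact (overlapBound_tangent hε hs hs1 ht0.le ht1 (fun h => absurd h ht0.ne') hts).le
  have hdef : u ≠ 0 → 0 < ε * (1 - exp (logDeficit p 1 u)) := by
    intro hu
    have hsg := logDeficit_sign h0 h1 h2 hu
    have hm : ε * logDeficit p 1 u < 0 := by
      by_contra! hcon
      have h3 := mul_pos hε hsg
      -- Multiplying the two sign conditions produces -ε times the deficit times a square, so ε and
      -- the deficit have opposite signs.
      have h4 : ε * (p * (p - 1) * (p - 2)) * (p * (p - 1) * (2 - p) * logDeficit p 1 u)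
        = -((ε * logDeficit p 1 u) * (p * (p - 1) * (p - 2)) ^ 2) := by ring
      rw [h4] at h3
      linarith [mul_nonneg hcon (sq_nonneg (p * (p - 1) * (p - 2)))]
    rcases mul_neg_iff.1 hm with ⟨h3, h4⟩ | ⟨h3, h4⟩
    · exact mul_pos h3 (by linarith [exp_lt_one_iff.2 h4])
    · exact mul_pos_of_neg_of_neg h3 (by linarith [one_lt_exp_iff.2 h4])
  constructor
  · have : 0 ≤ ε * (1 - exp (logDeficit p 1 u)) := by
      by_cases hu : u = 0
      · simp [hu, logDeficit_zero]
      · exact (hdef hu).le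
    positivity
  · intro hxy
    have hu : u ≠ 0 := by rintro rfl; simp at hxy
    have := hdef hu
    positivity

theorem tangent_bound_left {p ε s x : ℝ} (hε : 0 < ε * (p * (p - 1) * (p - 2))) (hp : 0 < p)
    (hs : 0 < s) (hs1 : s ≤ 1) (hx : 0 < x) :
    0 < ε * ((overlapBound p s - s * overlapBoundDeriv p s) * x ^ p - x ^ p) := by
  have h := overlapBound_tangent hε hs hs1 le_rfl zero_le_one (fun _ => hp) hs.ne
  have hb : overlapBound p 0 = 1 := by
    rw [overlapBound, zero_rpow (by positivity)]
    simp
  rw [hb] at h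
  have hxp : 0 < x ^ p := rpow_pos_of_pos hx _
  calc (0 : ℝ) < x ^ p * (ε * (overlapBound p s + overlapBoundDeriv p s * (0 - s) - 1)) :=
        mul_pos hxp h
    _ = _ := by ring

/-- The integrand form of the main inequality: a bound of `(x + y)^p` by a combination of
`x^p + y^p` and `(x y)^(p/2)`, strict off the diagonal. -/
theorem tangent_bound {p ε s x y : ℝ} (hε : 0 < ε * (p * (p - 1) * (p - 2)))
    (hs : 0 < s) (hs1 : s ≤ 1) (hx : 0 ≤ x) (hy : 0 ≤ y) (hneg : p < 0 → 0 < x ∧ 0 < y) :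
    0 ≤ ε * ((overlapBound p s - s * overlapBoundDeriv p s) * (x ^ p + y ^ p)
      + 2 * overlapBoundDeriv p s * (x * y) ^ (p / 2) - (x + y) ^ p) ∧
    (x ≠ y → 0 < ε * ((overlapBound p s - s * overlapBoundDeriv p s) * (x ^ p + y ^ p)
      + 2 * overlapBoundDeriv p s * (x * y) ^ (p / 2) - (x + y) ^ p)) := by
  have h0 : p ≠ 0 := by rintro rfl; simp at hε
  rcases hx.eq_or_lt with rfl | hx'
  · have hp : 0 < p := lt_of_le_of_ne (not_lt.1 fun h => (hneg h).1.false) h0.symm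
    have hz : (0 : ℝ) ^ p = 0 := zero_rpow h0
    have hz2 : (0 : ℝ) ^ (p / 2) = 0 := zero_rpow (by positivity)
    rcases hy.eq_or_lt with rfl | hy'
    · simp [hz, hz2]
    · have := tangent_bound_left hε hp hs hs1 hy'
      simp only [hz, hz2, zero_mul, mul_zero, zero_add, add_zero]
      exact ⟨this.le, fun _ => this⟩
  rcases hy.eq_or_lt with rfl | hy'
  · have hp : 0 < p := lt_of_le_of_ne (not_lt.1 fun h => (hneg h).2.false) h0.symm
    have hz : (0 : ℝ) ^ p = 0 := zero_rpow h0
    have hz2 : (0 : ℝ) ^ (p / 2) = 0 := zero_rpow (by positivity)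
    have := tangent_bound_left hε hp hs hs1 hx'
    simp only [hz, hz2, mul_zero, add_zero]
    exact ⟨this.le, fun _ => this⟩
  exact tangent_bound_of_pos hε hs hs1 hx' hy'

theorem two_mul_rpow_half_le {p x y : ℝ} (hx : 0 ≤ x) (hy : 0 ≤ y) :
    2 * (x * y) ^ (p / 2) ≤ x ^ p + y ^ p := by
  have e : ∀ z : ℝ, 0 ≤ z → z ^ p = (z ^ (p / 2)) ^ 2 := fun z hz => by
    rw [← rpow_mul_natCast hz]
    norm_num
  rw [mul_rpow hx hy, e x hx, e y hy]
  nlinarith [sq_nonneg (x ^ (p / 2) - y ^ (p / 2))]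

theorem rpow_half_mul_self {p x : ℝ} (hx : 0 ≤ x) : (x * x) ^ (p / 2) = x ^ p := by
  rw [← pow_two, ← rpow_natCast_mul hx]
  congr 1
  push_cast
  ring

/-! ### The inequality for integrals of nonnegative real functions. -/

section Integral

variable {Ω : Type*} [MeasurableSpace Ω] {μ : Measure Ω} {x y : Ω → ℝ} {p ε : ℝ}

theorem integrable_mul_rpow_half (hx : AEMeasurable x μ) (hy : AEMeasurable y μ)
    (hx0 : ∀ ω, 0 ≤ x ω) (hy0 : ∀ ω, 0 ≤ y ω)
    (hxp : Integrable (fun ω => x ω ^ p) μ) (hyp : Integrable (fun ω => y ω ^ p) μ) :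
    Integrable (fun ω => (x ω * y ω) ^ (p / 2)) μ := by
  refine (hxp.add hyp).mono' ((hx.mul hy).pow_const _).aestronglyMeasurable
    (ae_of_all _ fun ω => ?_)
  have h1 := mul_nonneg (hx0 ω) (hy0 ω)
  have h2 := rpow_nonneg h1 (p / 2)
  rw [norm_of_nonneg h2]
  have := two_mul_rpow_half_le (p := p) (hx0 ω) (hy0 ω)
  simp only [Pi.add_apply]
  linarith

theorem integrable_add_rpow (hx : AEMeasurable x μ) (hy : AEMeasurable y μ)
    (hx0 : ∀ ω, 0 ≤ x ω) (hy0 : ∀ ω, 0 ≤ y ω) (hneg : p < 0 → ∀ᵐ ω ∂μ, 0 < x ω ∧ 0 < y ω)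
    (hxp : Integrable (fun ω => x ω ^ p) μ) (hyp : Integrable (fun ω => y ω ^ p) μ) :
    Integrable (fun ω => (x ω + y ω) ^ p) μ := by
  have hm := ((hx.add hy).pow_const p).aestronglyMeasurable
  rcases lt_or_ge p 0 with h | h
  · refine hxp.mono' hm ?_
    filter_upwards [hneg h] with ω hω
    rw [norm_of_nonneg (rpow_nonneg (add_nonneg hω.1.le hω.2.le) p)]
    exact rpow_le_rpow_of_nonpos hω.1 (by linarith [hω.2]) h.le
  · refine ((hxp.add hyp).const_mul (2 ^ p)).mono' hm (ae_of_all _ fun ω => ?_)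
    have h1 := rpow_nonneg (hx0 ω) p
    have h2 := rpow_nonneg (hy0 ω) p
    rw [norm_of_nonneg (rpow_nonneg (add_nonneg (hx0 ω) (hy0 ω)) p)]
    have h3 : (0 : ℝ) ≤ 2 ^ p := by positivity
    rcases le_total (x ω) (y ω) with h4 | h4
    · calc (x ω + y ω) ^ p ≤ (2 * y ω) ^ p :=
            rpow_le_rpow (add_nonneg (hx0 ω) (hy0 ω)) (by linarith) h
        _ = 2 ^ p * y ω ^ p := mul_rpow two_pos.le (hy0 ω)
        _ ≤ 2 ^ p * (x ω ^ p + y ω ^ p) := by gcongr; linarith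
    · calc (x ω + y ω) ^ p ≤ (2 * x ω) ^ p :=
            rpow_le_rpow (add_nonneg (hx0 ω) (hy0 ω)) (by linarith) h
        _ = 2 ^ p * x ω ^ p := mul_rpow two_pos.le (hx0 ω)
        _ ≤ 2 ^ p * (x ω ^ p + y ω ^ p) := by gcongr; linarith

/-- Here `tangent_bound` is integrated with its tangent point at the averaged overlap s = 2J/I.
Positivity of J keeps s away from 0, where the slope may be infinite; disjoint supports are treated
separately. -/
theorem integral_bound (hε : 0 < ε * (p * (p - 1) * (p - 2)))
    (hx : AEMeasurable x μ) (hy : AEMeasurable y μ)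
    (hx0 : ∀ ω, 0 ≤ x ω) (hy0 : ∀ ω, 0 ≤ y ω) (hneg : p < 0 → ∀ᵐ ω ∂μ, 0 < x ω ∧ 0 < y ω)
    (hxp : Integrable (fun ω => x ω ^ p) μ) (hyp : Integrable (fun ω => y ω ^ p) μ)
    {I J : ℝ} (hI : I = ∫ ω, (x ω ^ p + y ω ^ p) ∂μ) (hJ : J = ∫ ω, (x ω * y ω) ^ (p / 2) ∂μ)
    (hJ0 : 0 < J) :
    0 ≤ ε * (overlapBound p (2 * J / I) * I - ∫ ω, (x ω + y ω) ^ p ∂μ) ∧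
    (∫ ω, (x ω + y ω) ^ p ∂μ = overlapBound p (2 * J / I) * I ↔ x =ᵐ[μ] y) := by
  have iJ := integrable_mul_rpow_half hx hy hx0 hy0 hxp hyp
  have iS := integrable_add_rpow hx hy hx0 hy0 hneg hxp hyp
  have iI : Integrable (fun ω => x ω ^ p + y ω ^ p) μ := hxp.add hyp
  have hJI : 2 * J ≤ I := by
    rw [hI, hJ, ← integral_const_mul]
    exact integral_mono (iJ.const_mul 2) iI fun ω => two_mul_rpow_half_le (hx0 ω) (hy0 ω)
  have hI0 : 0 < I := by linarith
  set s := 2 * J / I with hs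
  have hs0 : 0 < s := by positivity
  have hs1 : s ≤ 1 := (div_le_one hI0).2 hJI
  set D : Ω → ℝ := fun ω =>
    ε * ((overlapBound p s - s * overlapBoundDeriv p s) * (x ω ^ p + y ω ^ p)
      + 2 * overlapBoundDeriv p s * (x ω * y ω) ^ (p / 2) - (x ω + y ω) ^ p) with hD
  have iA := iI.const_mul (overlapBound p s - s * overlapBoundDeriv p s)
  have iB := iJ.const_mul (2 * overlapBoundDeriv p s)
  have iAB : Integrable (fun ω => (overlapBound p s - s * overlapBoundDeriv p s)
      * (x ω ^ p + y ω ^ p) + 2 * overlapBoundDeriv p s * (x ω * y ω) ^ (p / 2)) μ := iA.add iB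
  have iD : Integrable D μ := (iAB.sub iS).const_mul ε
  have hint : ∫ ω, D ω ∂μ = ε * (overlapBound p s * I - ∫ ω, (x ω + y ω) ^ p ∂μ) := by
    rw [hD, integral_const_mul, integral_sub iAB iS, integral_add iA iB,
      integral_const_mul, integral_const_mul, ← hI, ← hJ]
    -- This is why s is the right tangent point: the two terms carrying the slope cancel after
    -- integration.
    have : 2 * J = s * I := by rw [hs]; field_simp
    linear_combination ε * overlapBoundDeriv p s * this
  have hpt : ∀ᵐ ω ∂μ, 0 ≤ D ω ∧ (x ω ≠ y ω → 0 < D ω) := by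
    have hneg' : ∀ᵐ ω ∂μ, p < 0 → 0 < x ω ∧ 0 < y ω := by
      by_cases h : p < 0
      · filter_upwards [hneg h] with ω hω _ using hω
      · exact ae_of_all _ fun ω h' => absurd h' h
    filter_upwards [hneg'] with ω hω
    exact tangent_bound hε hs0 hs1 (hx0 ω) (hy0 ω) hω
  have hD0 : 0 ≤ᵐ[μ] D := by filter_upwards [hpt] with ω hω using hω.1
  refine ⟨hint ▸ integral_nonneg_of_ae hD0, fun heq => ?_, fun heq => ?_⟩
  · rw [heq, sub_self, mul_zero, integral_eq_zero_iff_of_nonneg_ae hD0 iD] at hint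
    filter_upwards [hint, hpt] with ω h1 h2
    by_contra hne
    exact (h2.2 hne).ne' h1
  · have e1 : J = ∫ ω, x ω ^ p ∂μ := by
      rw [hJ]
      refine integral_congr_ae ?_
      filter_upwards [heq] with ω hω
      rw [← hω, rpow_half_mul_self (hx0 ω)]
    have e2 : I = 2 * J := by
      rw [hI, e1, ← integral_const_mul]
      refine integral_congr_ae ?_
      filter_upwards [heq] with ω hω
      rw [← hω]
      ring
    have e3 : ∫ ω, (x ω + y ω) ^ p ∂μ = 2 ^ p * J := by
      rw [e1, ← integral_const_mul]
      refine integral_congr_ae ?_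
      filter_upwards [heq] with ω hω
      rw [← hω, ← two_mul, mul_rpow two_pos.le (hx0 ω)]
    have e4 : s = 1 := by rw [hs, ← e2, div_self hI0.ne']
    rw [e3, e4, e2, overlapBound, one_rpow, one_add_one_eq_two, ← mul_assoc,
      rpow_sub_one two_ne_zero, div_mul_cancel₀ _ two_ne_zero]

end Integral

/-! ### Passage to extended nonnegative integrals. -/

section Lintegral

variable {Ω 𝕜 : Type*} [MeasurableSpace Ω] [RCLike 𝕜] {μ : Measure Ω} {f g : Ω → 𝕜} {p : ℝ}

theorem ae_ne_zero_of_absPowInt_lt_top (hp : p < 0) (hf : AEMeasurable f μ)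
    (h : absPowInt p f μ < ∞) : ∀ᵐ ω ∂μ, f ω ≠ 0 := by
  filter_upwards [ae_lt_top' (hf.enorm.pow_const p) h.ne] with ω hω h0
  simp [h0, ENNReal.zero_rpow_of_neg hp] at hω

theorem enorm_rpow_eq_ofReal {r : ℝ} (hr : 0 ≤ r) (hp : p < 0 → 0 < r) (h0 : p ≠ 0) :
    ENNReal.ofReal r ^ p = ENNReal.ofReal (r ^ p) := by
  rcases lt_or_gt_of_ne h0 with h | h
  · exact ENNReal.ofReal_rpow_of_pos (hp h)
  · exact ENNReal.ofReal_rpow_of_nonneg hr h.le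

/-- For p < 0 the power 0^p is ∞ in `ℝ≥0∞` but 0 in `ℝ`, so the zeros have to be negligible. -/
theorem absPowInt_eq_lintegral_ofReal (h0 : p ≠ 0) (hne : p < 0 → ∀ᵐ ω ∂μ, f ω ≠ 0) :
    absPowInt p f μ = ∫⁻ ω, ENNReal.ofReal (‖f ω‖ ^ p) ∂μ := by
  have hne' : ∀ᵐ ω ∂μ, p < 0 → f ω ≠ 0 := by
    by_cases h : p < 0
    · filter_upwards [hne h] with ω hω _ using hω
    · exact ae_of_all _ fun ω h' => absurd h' h
  refine lintegral_congr_ae ?_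
  filter_upwards [hne'] with ω hω
  rw [← ofReal_norm, enorm_rpow_eq_ofReal (norm_nonneg _) (fun h => norm_pos_iff.2 (hω h)) h0]

theorem integrable_norm_rpow (h0 : p ≠ 0) (hf : AEMeasurable f μ) (h : absPowInt p f μ < ∞) :
    Integrable (fun ω => ‖f ω‖ ^ p) μ := by
  refine ⟨(hf.norm.pow_const p).aestronglyMeasurable, ?_⟩
  rw [hasFiniteIntegral_iff_ofReal (ae_of_all _ fun ω => rpow_nonneg (norm_nonneg _) p),
    ← absPowInt_eq_lintegral_ofReal h0 fun hp => ae_ne_zero_of_absPowInt_lt_top hp hf h]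
  exact h

theorem absPowInt_eq_ofReal (h0 : p ≠ 0) (hne : p < 0 → ∀ᵐ ω ∂μ, f ω ≠ 0)
    (hi : Integrable (fun ω => ‖f ω‖ ^ p) μ) :
    absPowInt p f μ = ENNReal.ofReal (∫ ω, ‖f ω‖ ^ p ∂μ) := by
  rw [absPowInt_eq_lintegral_ofReal h0 hne,
    ofReal_integral_eq_lintegral_ofReal hi (ae_of_all _ fun ω => rpow_nonneg (norm_nonneg _) p)]

theorem pNorm_rpow (h0 : p ≠ 0) : pNorm p f μ ^ p = absPowInt p f μ := by
  rw [pNorm, ← ENNReal.rpow_mul, one_div, inv_mul_cancel₀ h0, ENNReal.rpow_one]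

theorem lintegral_enorm_rpow_add (hf : AEMeasurable f μ) :
    ∫⁻ ω, (‖f ω‖ₑ ^ p + ‖g ω‖ₑ ^ p) ∂μ = absPowInt p f μ + absPowInt p g μ :=
  lintegral_add_left' (hf.enorm.pow_const p) _

theorem mainRHS_eq_ofReal (h0 : p ≠ 0) (hf : AEMeasurable f μ) {a b J : ℝ}
    (ha : absPowInt p f μ = ENNReal.ofReal a) (hb : absPowInt p g μ = ENNReal.ofReal b)
    (ha0 : 0 ≤ a) (hb0 : 0 ≤ b) (hab : 0 < a + b)
    (hJ : absPowInt (p / 2) (fun ω => f ω * g ω) μ = ENNReal.ofReal J) (hJ0 : 0 < J) :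
    mainRHS p f g μ = ENNReal.ofReal (overlapBound p (2 * J / (a + b)) * (a + b)) := by
  have e1 : (1 : ℝ) / (p / 2) = 2 / p := by field_simp
  have e2 : (2 : ℝ≥0∞) = ENNReal.ofReal 2 := by simp
  have hq : (2 : ℝ≥0∞) ^ (2 / p) * ENNReal.ofReal J ^ (2 / p) / ENNReal.ofReal (a + b) ^ (2 / p)
      = ENNReal.ofReal ((2 * J / (a + b)) ^ (2 / p)) := by
    rw [e2, ENNReal.ofReal_rpow_of_pos two_pos, ENNReal.ofReal_rpow_of_pos hJ0,
      ENNReal.ofReal_rpow_of_pos hab, ← ENNReal.ofReal_mul (by positivity),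
      ← ENNReal.ofReal_div_of_pos (by positivity), div_rpow (by positivity) hab.le,
      mul_rpow two_pos.le hJ0.le]
  have hpos : 0 < (2 * J / (a + b)) ^ (2 / p) := by positivity
  rw [mainRHS, lintegral_enorm_rpow_add hf, pNorm_rpow h0, pNorm_rpow h0, pNorm, ha, hb, hJ, e1,
    ← ENNReal.ofReal_add ha0 hb0, hq, ← ENNReal.ofReal_one, ← ENNReal.ofReal_add one_pos.le hpos.le,
    ENNReal.ofReal_rpow_of_pos (by positivity), ← ENNReal.ofReal_mul (by positivity), overlapBound]

/-- This transports `integral_bound` for the norms. The overlap integral is positive because the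
supports meet in positive measure. The sign ε treats both directions at once. -/
theorem lintegral_enorm_add_rpow_vs_mainRHS {ε : ℝ} (hε : 0 < ε * (p * (p - 1) * (p - 2)))
    (hf : AEMeasurable f μ) (hg : AEMeasurable g μ)
    (hfp : absPowInt p f μ < ∞) (hgp : absPowInt p g μ < ∞)
    (hfg : μ (Function.support f ∩ Function.support g) ≠ 0) :
    ∃ a b : ℝ, 0 ≤ a ∧ 0 ≤ b ∧ ∫⁻ ω, (‖f ω‖ₑ + ‖g ω‖ₑ) ^ p ∂μ = ENNReal.ofReal a ∧
      mainRHS p f g μ = ENNReal.ofReal b ∧ 0 ≤ ε * (b - a) ∧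
      (a = b ↔ (fun ω => ‖f ω‖) =ᵐ[μ] fun ω => ‖g ω‖) := by
  have h0 : p ≠ 0 := by rintro rfl; simp at hε
  have hp2 : p / 2 ≠ 0 := div_ne_zero h0 two_ne_zero
  have hfn := fun hp => ae_ne_zero_of_absPowInt_lt_top hp hf hfp
  have hgn := fun hp => ae_ne_zero_of_absPowInt_lt_top hp hg hgp
  have hneg : p < 0 → ∀ᵐ ω ∂μ, 0 < ‖f ω‖ ∧ 0 < ‖g ω‖ := fun hp => by
    filter_upwards [hfn hp, hgn hp] with ω h1 h2
    exact ⟨norm_pos_iff.2 h1, norm_pos_iff.2 h2⟩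
  have hx0 : ∀ ω, 0 ≤ ‖f ω‖ := fun ω => norm_nonneg _
  have hy0 : ∀ ω, 0 ≤ ‖g ω‖ := fun ω => norm_nonneg _
  have iF := integrable_norm_rpow h0 hf hfp
  have iG := integrable_norm_rpow h0 hg hgp
  have iJ := integrable_mul_rpow_half hf.norm hg.norm hx0 hy0 iF iG
  have iS := integrable_add_rpow hf.norm hg.norm hx0 hy0 hneg iF iG
  have hJn : ∀ ω, 0 ≤ (‖f ω‖ * ‖g ω‖) ^ (p / 2) := fun ω =>
    rpow_nonneg (mul_nonneg (hx0 ω) (hy0 ω)) _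
  have hJ0 : 0 < ∫ ω, (‖f ω‖ * ‖g ω‖) ^ (p / 2) ∂μ := by
    rw [integral_pos_iff_support_of_nonneg hJn iJ]
    refine (pos_iff_ne_zero.2 hfg).trans_le (measure_mono fun ω hω => ?_)
    have h1 : 0 < ‖f ω‖ := norm_pos_iff.2 hω.1
    have h2 : 0 < ‖g ω‖ := norm_pos_iff.2 hω.2
    exact (rpow_pos_of_pos (mul_pos h1 h2) _).ne'
  have hJ : absPowInt (p / 2) (fun ω => f ω * g ω) μ
      = ENNReal.ofReal (∫ ω, (‖f ω‖ * ‖g ω‖) ^ (p / 2) ∂μ) := by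
    have hnm : (fun ω => (‖f ω‖ * ‖g ω‖) ^ (p / 2)) = fun ω => ‖f ω * g ω‖ ^ (p / 2) := by
      simp only [norm_mul]
    rw [hnm]
    refine absPowInt_eq_ofReal hp2 (fun hp => ?_) (hnm ▸ iJ)
    have hp' : p < 0 := by linarith
    filter_upwards [hfn hp', hgn hp'] with ω h1 h2 using mul_ne_zero h1 h2
  have hI : (∫ ω, ‖f ω‖ ^ p ∂μ) + ∫ ω, ‖g ω‖ ^ p ∂μ = ∫ ω, (‖f ω‖ ^ p + ‖g ω‖ ^ p) ∂μ :=
    (integral_add iF iG).symm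
  have hF0 : 0 ≤ ∫ ω, ‖f ω‖ ^ p ∂μ := integral_nonneg fun ω => rpow_nonneg (hx0 ω) p
  have hG0 : 0 ≤ ∫ ω, ‖g ω‖ ^ p ∂μ := integral_nonneg fun ω => rpow_nonneg (hy0 ω) p
  have hI0 : 0 < (∫ ω, ‖f ω‖ ^ p ∂μ) + ∫ ω, ‖g ω‖ ^ p ∂μ := by
    rw [hI]
    refine (mul_pos two_pos hJ0).trans_le ?_
    rw [← integral_const_mul]
    exact integral_mono (iJ.const_mul 2) (iF.add iG) fun ω => two_mul_rpow_half_le (hx0 ω) (hy0 ω)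
  have hb := integral_bound hε hf.norm hg.norm hx0 hy0 hneg iF iG hI rfl hJ0
  have hS0 : ∀ ω, 0 ≤ (‖f ω‖ + ‖g ω‖) ^ p := fun ω =>
    rpow_nonneg (add_nonneg (hx0 ω) (hy0 ω)) p
  refine ⟨_, _, integral_nonneg hS0, ?_, ?_, mainRHS_eq_ofReal h0 hf
    (absPowInt_eq_ofReal h0 hfn iF) (absPowInt_eq_ofReal h0 hgn iG) hF0 hG0 hI0 hJ hJ0, hb.1, hb.2⟩
  · unfold overlapBound
    positivity
  · rw [ofReal_integral_eq_lintegral_ofReal iS (ae_of_all _ hS0)]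
    have hneg' : ∀ᵐ ω ∂μ, p < 0 → 0 < ‖f ω‖ ∧ 0 < ‖g ω‖ := by
      by_cases h : p < 0
      · filter_upwards [hneg h] with ω hω _ using hω
      · exact ae_of_all _ fun ω h' => absurd h' h
    refine lintegral_congr_ae ?_
    filter_upwards [hneg'] with ω hω
    rw [← ofReal_norm, ← ofReal_norm, ← ENNReal.ofReal_add (hx0 ω) (hy0 ω),
      enorm_rpow_eq_ofReal (add_nonneg (hx0 ω) (hy0 ω))
        (fun h => add_pos (hω h).1 (hω h).2) h0]

theorem mainRHS_of_ae_mul_eq_zero (hp : 0 < p) (h : ∀ᵐ ω ∂μ, f ω * g ω = 0) :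
    mainRHS p f g μ = ∫⁻ ω, (‖f ω‖ₑ ^ p + ‖g ω‖ₑ ^ p) ∂μ := by
  have hz : absPowInt (p / 2) (fun ω => f ω * g ω) μ = 0 := by
    have e : absPowInt (p / 2) (fun ω => f ω * g ω) μ = ∫⁻ _, 0 ∂μ := by
      refine lintegral_congr_ae ?_
      filter_upwards [h] with ω hω
      rw [hω, enorm_zero, ENNReal.zero_rpow_of_pos (by positivity)]
    rw [e, lintegral_zero]
  rw [mainRHS, pNorm, hz, ENNReal.zero_rpow_of_pos (by positivity)]
  simp

theorem lintegral_enorm_add_rpow_of_ae_mul_eq_zero (hp : 0 < p) (h : ∀ᵐ ω ∂μ, f ω * g ω = 0) :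
    ∫⁻ ω, (‖f ω‖ₑ + ‖g ω‖ₑ) ^ p ∂μ = ∫⁻ ω, (‖f ω‖ₑ ^ p + ‖g ω‖ₑ ^ p) ∂μ := by
  refine lintegral_congr_ae ?_
  filter_upwards [h] with ω hω
  rcases mul_eq_zero.1 hω with h1 | h1 <;> simp [h1, ENNReal.zero_rpow_of_pos hp]

/-- Division by ∞ makes the quotient 0, so the prefactor is 1 and the infinite integral remains. -/
theorem mainRHS_of_eq_top (hp : 0 < p) (hf : AEMeasurable f μ)
    (h : absPowInt p f μ + absPowInt p g μ = ∞) : mainRHS p f g μ = ∞ := by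
  rw [mainRHS, lintegral_enorm_rpow_add hf, pNorm_rpow hp.ne', pNorm_rpow hp.ne', h,
    ENNReal.top_rpow_of_pos (by positivity), ENNReal.div_top]
  simp

theorem ae_mul_eq_zero_iff :
    (∀ᵐ ω ∂μ, f ω * g ω = 0) ↔ μ (Function.support f ∩ Function.support g) = 0 := by
  rw [ae_iff]
  refine iff_of_eq (congrArg (fun s => μ s = 0) ?_)
  ext ω
  simp

end Lintegral

/-! ### From |f| + |g| to f + g, and the cases of equality. -/

section Comparison

variable {Ω 𝕜 : Type*} [MeasurableSpace Ω] [RCLike 𝕜] {μ : Measure Ω} {f g : Ω → 𝕜} {p : ℝ}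

/-- By the parallelogram law, equality in the triangle inequality for vectors of equal norm leaves
‖a - b‖² = 0. -/
theorem eq_of_norm_eq_of_enorm_add_eq {a b : 𝕜} (h : ‖a‖ = ‖b‖)
    (hab : ‖a + b‖ₑ = ‖a‖ₑ + ‖b‖ₑ) : a = b := by
  have h1 : ‖a + b‖ = ‖a‖ + ‖b‖ := by
    have := congrArg ENNReal.toReal hab
    rwa [ENNReal.toReal_add enorm_ne_top enorm_ne_top, toReal_enorm, toReal_enorm,
      toReal_enorm] at this
  have h2 := parallelogram_law_with_norm 𝕜 a b
  rw [h1, h] at h2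
  have h3 : ‖a - b‖ = 0 := by
    have : ‖a - b‖ * ‖a - b‖ = 0 := by linarith
    exact mul_self_eq_zero.1 this
  exact sub_eq_zero.1 (norm_eq_zero.1 h3)

theorem ennreal_rpow_le_rpow_of_nonpos {a b : ℝ≥0∞} (hp : p ≤ 0) (hab : a ≤ b) :
    b ^ p ≤ a ^ p := by
  obtain ⟨q, rfl⟩ : ∃ q, p = -q := ⟨-p, by simp⟩
  rw [ENNReal.rpow_neg, ENNReal.rpow_neg, ENNReal.inv_le_inv]
  exact ENNReal.rpow_le_rpow hab (neg_nonpos.1 hp)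

theorem absPowInt_add_le (hp : 0 ≤ p) :
    absPowInt p (fun ω => f ω + g ω) μ ≤ ∫⁻ ω, (‖f ω‖ₑ + ‖g ω‖ₑ) ^ p ∂μ :=
  lintegral_mono fun _ => ENNReal.rpow_le_rpow (enorm_add_le _ _) hp

theorem le_absPowInt_add (hp : p ≤ 0) :
    ∫⁻ ω, (‖f ω‖ₑ + ‖g ω‖ₑ) ^ p ∂μ ≤ absPowInt p (fun ω => f ω + g ω) μ :=
  lintegral_mono fun _ => ennreal_rpow_le_rpow_of_nonpos hp (enorm_add_le _ _)

theorem absPowInt_add_of_enorm_add (h : ∀ᵐ ω ∂μ, ‖f ω + g ω‖ₑ = ‖f ω‖ₑ + ‖g ω‖ₑ) :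
    absPowInt p (fun ω => f ω + g ω) μ = ∫⁻ ω, (‖f ω‖ₑ + ‖g ω‖ₑ) ^ p ∂μ := by
  refine lintegral_congr_ae ?_
  filter_upwards [h] with ω hω
  rw [hω]

theorem enorm_add_of_ae_eq (h : f =ᵐ[μ] g) : ∀ᵐ ω ∂μ, ‖f ω + g ω‖ₑ = ‖f ω‖ₑ + ‖g ω‖ₑ := by
  filter_upwards [h] with ω hω
  rw [← hω, ← two_mul, ← two_mul, enorm_mul]
  congr 1
  rw [← ofReal_norm, RCLike.norm_ofNat]
  simp

theorem enorm_add_of_ae_mul_eq_zero (h : ∀ᵐ ω ∂μ, f ω * g ω = 0) :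
    ∀ᵐ ω ∂μ, ‖f ω + g ω‖ₑ = ‖f ω‖ₑ + ‖g ω‖ₑ := by
  filter_upwards [h] with ω hω
  rcases mul_eq_zero.1 hω with h1 | h1 <;> simp [h1]

theorem enorm_add_of_nonneg {f g : Ω → ℝ} (hf : ∀ᵐ ω ∂μ, 0 ≤ f ω) (hg : ∀ᵐ ω ∂μ, 0 ≤ g ω) :
    ∀ᵐ ω ∂μ, ‖f ω + g ω‖ₑ = ‖f ω‖ₑ + ‖g ω‖ₑ := by
  filter_upwards [hf, hg] with ω h1 h2
  rw [Real.enorm_of_nonneg h1, Real.enorm_of_nonneg h2, Real.enorm_of_nonneg (add_nonneg h1 h2),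
    ENNReal.ofReal_add h1 h2]

/-- Ordered integrands with the same finite integral agree almost everywhere. Injectivity of the
power then gives pointwise equality in the triangle inequality. -/
theorem ae_eq_of_absPowInt_add_eq (h0 : p ≠ 0) (hf : AEMeasurable f μ) (hg : AEMeasurable g μ)
    (hn : (fun ω => ‖f ω‖) =ᵐ[μ] fun ω => ‖g ω‖)
    (heq : absPowInt p (fun ω => f ω + g ω) μ = ∫⁻ ω, (‖f ω‖ₑ + ‖g ω‖ₑ) ^ p ∂μ)
    (hfin : ∫⁻ ω, (‖f ω‖ₑ + ‖g ω‖ₑ) ^ p ∂μ ≠ ∞) : f =ᵐ[μ] g := by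
  have hpow : ∀ᵐ ω ∂μ, ‖f ω + g ω‖ₑ ^ p = (‖f ω‖ₑ + ‖g ω‖ₑ) ^ p := by
    rcases lt_or_gt_of_ne h0 with h | h
    · have := ae_eq_of_ae_le_of_lintegral_le
        (f := fun ω => (‖f ω‖ₑ + ‖g ω‖ₑ) ^ p) (g := fun ω => ‖f ω + g ω‖ₑ ^ p) (μ := μ)
        (ae_of_all _ fun ω => ennreal_rpow_le_rpow_of_nonpos h.le (enorm_add_le _ _)) hfin
        ((hf.add hg).enorm.pow_const p) heq.le
      filter_upwards [this] with ω hω using hω.symm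
    · exact ae_eq_of_ae_le_of_lintegral_le
        (f := fun ω => ‖f ω + g ω‖ₑ ^ p) (g := fun ω => (‖f ω‖ₑ + ‖g ω‖ₑ) ^ p)
        (ae_of_all _ fun ω => ENNReal.rpow_le_rpow (enorm_add_le _ _) h.le)
        (by rw [← heq] at hfin; exact hfin) ((hf.enorm.add hg.enorm).pow_const p) heq.ge
  filter_upwards [hn, hpow] with ω h1 h2
  exact eq_of_norm_eq_of_enorm_add_eq h1 (ENNReal.rpow_left_injective h0 h2)

theorem ae_norm_eq_of_ae_eq (h : f =ᵐ[μ] g) : (fun ω => ‖f ω‖) =ᵐ[μ] fun ω => ‖g ω‖ := by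
  filter_upwards [h] with ω hω
  rw [hω]

/-- Finiteness of a negative-power integral forbids zeros on a set of positive measure, so both
supports are conull. -/
theorem measure_eq_zero_of_disjoint_support_of_neg (hp : p < 0) (hf : AEMeasurable f μ)
    (hg : AEMeasurable g μ) (hfp : absPowInt p f μ < ∞) (hgp : absPowInt p g μ < ∞)
    (h : μ (Function.support f ∩ Function.support g) = 0) : μ = 0 := by
  rw [← ae_mul_eq_zero_iff] at h
  rw [← ae_eq_bot, ← eventually_false_iff_eq_bot]
  filter_upwards [h, ae_ne_zero_of_absPowInt_lt_top hp hf hfp,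
    ae_ne_zero_of_absPowInt_lt_top hp hg hgp] with ω h1 h2 h3
  exact mul_ne_zero h2 h3 h1

theorem lintegral_enorm_add_rpow_eq_mainRHS_of_disjoint (hp : 0 < p)
    (h : μ (Function.support f ∩ Function.support g) = 0) :
    ∫⁻ ω, (‖f ω‖ₑ + ‖g ω‖ₑ) ^ p ∂μ = mainRHS p f g μ := by
  rw [← ae_mul_eq_zero_iff] at h
  rw [mainRHS_of_ae_mul_eq_zero hp h, lintegral_enorm_add_rpow_of_ae_mul_eq_zero hp h]

theorem lintegral_enorm_add_rpow_le_mainRHS (hp : 0 < p) (hε : 0 < p * (p - 1) * (p - 2))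
    (hf : AEMeasurable f μ) (hg : AEMeasurable g μ) :
    ∫⁻ ω, (‖f ω‖ₑ + ‖g ω‖ₑ) ^ p ∂μ ≤ mainRHS p f g μ := by
  by_cases hfin : absPowInt p f μ + absPowInt p g μ = ∞
  · simp [mainRHS_of_eq_top hp hf hfin]
  by_cases hd : μ (Function.support f ∩ Function.support g) = 0
  · exact (lintegral_enorm_add_rpow_eq_mainRHS_of_disjoint hp hd).le
  rw [ENNReal.add_eq_top, not_or] at hfin
  obtain ⟨a, b, ha, hb, e1, e2, h, -⟩ := lintegral_enorm_add_rpow_vs_mainRHS (ε := 1)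
    (by simpa using hε) hf hg (lt_top_iff_ne_top.2 hfin.1) (lt_top_iff_ne_top.2 hfin.2) hd
  rw [e1, e2]
  exact ENNReal.ofReal_le_ofReal (by linarith)

theorem mainRHS_le_lintegral_enorm_add_rpow_of_finite (hε : p * (p - 1) * (p - 2) < 0)
    (hf : AEMeasurable f μ) (hg : AEMeasurable g μ)
    (hfp : absPowInt p f μ < ∞) (hgp : absPowInt p g μ < ∞) :
    mainRHS p f g μ ≤ ∫⁻ ω, (‖f ω‖ₑ + ‖g ω‖ₑ) ^ p ∂μ := by
  have h0 : p ≠ 0 := by rintro rfl; simp at hε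
  by_cases hd : μ (Function.support f ∩ Function.support g) = 0
  · rcases lt_or_gt_of_ne h0 with h | h
    · simp [measure_eq_zero_of_disjoint_support_of_neg h hf hg hfp hgp hd, mainRHS]
    · exact (lintegral_enorm_add_rpow_eq_mainRHS_of_disjoint h hd).ge
  obtain ⟨a, b, ha, hb, e1, e2, h, -⟩ := lintegral_enorm_add_rpow_vs_mainRHS (ε := -1)
    (by simpa using hε) hf hg hfp hgp hd
  rw [e1, e2]
  exact ENNReal.ofReal_le_ofReal (by linarith)

theorem mainRHS_le_lintegral_enorm_add_rpow (hp : 1 < p) (hp2 : p < 2)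
    (hf : AEMeasurable f μ) (hg : AEMeasurable g μ) :
    mainRHS p f g μ ≤ ∫⁻ ω, (‖f ω‖ₑ + ‖g ω‖ₑ) ^ p ∂μ := by
  have hp0 : 0 < p := by linarith
  by_cases hfin : absPowInt p f μ + absPowInt p g μ = ∞
  · have : ∫⁻ ω, (‖f ω‖ₑ + ‖g ω‖ₑ) ^ p ∂μ = ∞ := by
      rcases ENNReal.add_eq_top.1 hfin with h | h <;>
        refine eq_top_iff.2 (h.ge.trans (lintegral_mono fun ω => ENNReal.rpow_le_rpow ?_ hp0.le))
      · exact le_self_add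
      · exact le_add_self
    simp [this]
  rw [ENNReal.add_eq_top, not_or] at hfin
  exact mainRHS_le_lintegral_enorm_add_rpow_of_finite
    (mul_neg_of_pos_of_neg (mul_pos hp0 (by linarith)) (by linarith)) hf hg
    (lt_top_iff_ne_top.2 hfin.1) (lt_top_iff_ne_top.2 hfin.2)

/-- Equality of `∫ (|f| + |g|)^p` with the right-hand side of the main inequality. -/
theorem lintegral_enorm_add_rpow_eq_mainRHS_iff (hε : p * (p - 1) * (p - 2) ≠ 0)
    (hf : AEMeasurable f μ) (hg : AEMeasurable g μ)
    (hfp : absPowInt p f μ < ∞) (hgp : absPowInt p g μ < ∞)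
    (hd : μ (Function.support f ∩ Function.support g) ≠ 0) :
    ∫⁻ ω, (‖f ω‖ₑ + ‖g ω‖ₑ) ^ p ∂μ ≠ ∞ ∧
    (∫⁻ ω, (‖f ω‖ₑ + ‖g ω‖ₑ) ^ p ∂μ = mainRHS p f g μ ↔
      (fun ω => ‖f ω‖) =ᵐ[μ] fun ω => ‖g ω‖) := by
  -- Taking ε to be the product itself makes the sign condition a nonzero square, so the concave and
  -- convex cases need no separation.
  obtain ⟨a, b, ha, hb, e1, e2, -, h⟩ := lintegral_enorm_add_rpow_vs_mainRHS
    (ε := p * (p - 1) * (p - 2)) (mul_self_pos.2 hε) hf hg hfp hgp hd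
  rw [e1, e2, ← h]
  exact ⟨ENNReal.ofReal_ne_top, ENNReal.ofReal_eq_ofReal_iff ha hb⟩

theorem absPowInt_add_eq_mainRHS_iff (hε : p * (p - 1) * (p - 2) ≠ 0)
    (hf : AEMeasurable f μ) (hg : AEMeasurable g μ)
    (hfp : absPowInt p f μ < ∞) (hgp : absPowInt p g μ < ∞)
    (hd : μ (Function.support f ∩ Function.support g) ≠ 0)
    (hsplit : absPowInt p (fun ω => f ω + g ω) μ = mainRHS p f g μ →
      absPowInt p (fun ω => f ω + g ω) μ = ∫⁻ ω, (‖f ω‖ₑ + ‖g ω‖ₑ) ^ p ∂μ) :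
    absPowInt p (fun ω => f ω + g ω) μ = mainRHS p f g μ ↔ f =ᵐ[μ] g := by
  have h0 : p ≠ 0 := by rintro rfl; simp at hε
  obtain ⟨hfin, hiff⟩ := lintegral_enorm_add_rpow_eq_mainRHS_iff hε hf hg hfp hgp hd
  refine ⟨fun h => ?_, fun h => ?_⟩
  · have h1 := hsplit h
    exact ae_eq_of_absPowInt_add_eq h0 hf hg (hiff.1 (h1.symm.trans h)) h1 hfin
  · rw [absPowInt_add_of_enorm_add (enorm_add_of_ae_eq h)]
    exact hiff.2 (ae_norm_eq_of_ae_eq h)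

theorem absPowInt_add_eq_mainRHS_iff_of_pos (hp : 0 < p) (hε : p * (p - 1) * (p - 2) ≠ 0)
    (hf : AEMeasurable f μ) (hg : AEMeasurable g μ)
    (hfp : absPowInt p f μ < ∞) (hgp : absPowInt p g μ < ∞)
    (hsplit : absPowInt p (fun ω => f ω + g ω) μ = mainRHS p f g μ →
      absPowInt p (fun ω => f ω + g ω) μ = ∫⁻ ω, (‖f ω‖ₑ + ‖g ω‖ₑ) ^ p ∂μ) :
    absPowInt p (fun ω => f ω + g ω) μ = mainRHS p f g μ ↔
      μ (Function.support f ∩ Function.support g) = 0 ∨ f =ᵐ[μ] g := by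
  by_cases hd : μ (Function.support f ∩ Function.support g) = 0
  · simp only [hd, true_or, iff_true]
    rw [absPowInt_add_of_enorm_add (enorm_add_of_ae_mul_eq_zero (ae_mul_eq_zero_iff.2 hd)),
      lintegral_enorm_add_rpow_eq_mainRHS_of_disjoint hp hd]
  · rw [absPowInt_add_eq_mainRHS_iff hε hf hg hfp hgp hd hsplit, or_iff_right hd]

theorem absPowInt_add_le_mainRHS_one :
    absPowInt 1 (fun ω => f ω + g ω) μ ≤ mainRHS 1 f g μ := by
  refine (absPowInt_add_le zero_le_one).trans_eq ?_
  simp [mainRHS]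

/-- At p = 2 the bound B(t) = 1 + t is affine, and expanding (|f| + |g|)² gives equality for |f| +
|g|; only the triangle inequality is lost. -/
theorem absPowInt_add_le_mainRHS_two (hf : AEMeasurable f μ) (hg : AEMeasurable g μ) :
    absPowInt 2 (fun ω => f ω + g ω) μ ≤ mainRHS 2 f g μ := by
  refine (absPowInt_add_le two_pos.le).trans ?_
  by_cases htop : absPowInt 2 f μ + absPowInt 2 g μ = ∞
  · simp [mainRHS_of_eq_top two_pos hf htop]
  by_cases hd : μ (Function.support f ∩ Function.support g) = 0
  · exact (lintegral_enorm_add_rpow_eq_mainRHS_of_disjoint two_pos hd).le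
  -- The sum is cancelled against the denominator of the quotient at the end, which requires it to
  -- be nonzero as well as finite.
  have hz : absPowInt 2 f μ + absPowInt 2 g μ ≠ 0 := by
    intro h
    refine hd (ae_mul_eq_zero_iff.1 ?_)
    have h1 := (add_eq_zero.1 h).1
    rw [absPowInt, lintegral_eq_zero_iff' (hf.enorm.pow_const _)] at h1
    filter_upwards [h1] with ω hω
    simp only [Pi.zero_apply, ENNReal.rpow_eq_zero_iff] at hω
    simp_all
  have hsq : ∀ a b : ℝ≥0∞, (a + b) ^ (2 : ℝ) = a ^ (2 : ℝ) + b ^ (2 : ℝ) + 2 * (a * b) := by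
    intro a b
    rw [ENNReal.rpow_two, ENNReal.rpow_two, ENNReal.rpow_two]
    ring
  have hN : ∫⁻ ω, 2 * (‖f ω‖ₑ * ‖g ω‖ₑ) ∂μ = 2 * absPowInt (2 / 2) (fun ω => f ω * g ω) μ := by
    rw [lintegral_const_mul' _ _ ENNReal.ofNat_ne_top, absPowInt]
    simp [enorm_mul]
  have hL : ∫⁻ ω, (‖f ω‖ₑ + ‖g ω‖ₑ) ^ (2 : ℝ) ∂μ = absPowInt 2 f μ + absPowInt 2 g μ
      + 2 * absPowInt (2 / 2) (fun ω => f ω * g ω) μ := by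
    simp only [hsq]
    rw [← lintegral_enorm_rpow_add hf, ← hN]
    exact lintegral_add_left' ((hf.enorm.pow_const _).add (hg.enorm.pow_const _)) _
  rw [hL, mainRHS, lintegral_enorm_rpow_add hf, pNorm_rpow two_ne_zero, pNorm_rpow two_ne_zero,
    pNorm]
  norm_num only [div_self, ENNReal.rpow_one, one_div]
  rw [add_mul, one_mul, ENNReal.div_mul_cancel hz htop]

end Comparison

/-! ### Sharpness by constant functions. -/

/-- For the constants e^u and e^(-u) the total mass cancels in the overlap, which becomes
cosh(pu)^(-2/p). By `two_cosh_rpow_eq` the two sides of the inequality then differ exactly by the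
factor exp(`logDeficit p q u`). -/
theorem powerRHS_const {Ω : Type*} [MeasurableSpace Ω] {μ : Measure Ω} (hμ : 0 < μ Set.univ)
    (hμ' : μ Set.univ < ∞) {p : ℝ} (h0 : p ≠ 0) (q u : ℝ) :
    absPowInt p (fun _ : Ω => exp u) μ < ∞ ∧ absPowInt p (fun _ : Ω => exp (-u)) μ < ∞ ∧
    absPowInt p (fun _ : Ω => exp u + exp (-u)) μ
      = ENNReal.ofReal ((2 * cosh u) ^ p) * μ Set.univ ∧
    powerRHS p q (fun _ : Ω => exp u) (fun _ => exp (-u)) μ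
      = ENNReal.ofReal (2 * cosh (p * u) * (1 + cosh (p * u) ^ (-(2 * q / p))) ^ (p - 1))
        * μ Set.univ := by
  obtain ⟨e1, -, -⟩ := exp_symm_rpow p 0 u
  simp only [zero_add, zero_sub, mul_zero, exp_zero, one_mul] at e1
  have hint : ∀ (r c : ℝ), 0 < c →
      absPowInt r (fun _ : Ω => c) μ = ENNReal.ofReal (c ^ r) * μ Set.univ := fun r c hc => by
    rw [absPowInt, lintegral_const, Real.enorm_of_nonneg hc.le, ENNReal.ofReal_rpow_of_pos hc]
  have c2 := cosh_pos (p * u)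
  obtain ⟨M, hM0, hM⟩ : ∃ M : ℝ, 0 < M ∧ μ Set.univ = ENNReal.ofReal M :=
    ⟨(μ Set.univ).toReal, ENNReal.toReal_pos hμ.ne' hμ'.ne, (ENNReal.ofReal_toReal hμ'.ne).symm⟩
  have hsum : absPowInt p (fun _ : Ω => exp u) μ + absPowInt p (fun _ : Ω => exp (-u)) μ
      = ENNReal.ofReal (2 * cosh (p * u)) * μ Set.univ := by
    rw [hint p _ (exp_pos _), hint p _ (exp_pos _), ← add_mul,
      ← ENNReal.ofReal_add (by positivity) (by positivity), e1]
  have hov : overlap p (fun _ : Ω => exp u) (fun _ => exp (-u)) μ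
      = ENNReal.ofReal (cosh (p * u) ^ (-(2 / p))) := by
    have e3 : ENNReal.ofReal (2 * cosh (p * u)) * μ Set.univ / 2
        = ENNReal.ofReal (cosh (p * u) * M) := by
      rw [hM, ← ENNReal.ofReal_mul (by positivity), ← ENNReal.ofReal_ofNat 2,
        ← ENNReal.ofReal_div_of_pos two_pos]
      congr 1
      ring
    have e4 : (1 : ℝ) / (p / 2) = 2 / p := by field_simp
    rw [overlap, pNorm_rpow h0, pNorm_rpow h0, hsum, pNorm]
    simp only [← exp_add, add_neg_cancel, exp_zero]
    rw [e3, hint _ 1 one_pos, one_rpow, ENNReal.ofReal_one, one_mul, hM, e4,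
      ENNReal.ofReal_rpow_of_pos hM0, ENNReal.ofReal_rpow_of_pos (by positivity),
      ← ENNReal.ofReal_mul (by positivity), mul_rpow c2.le hM0.le]
    congr 1
    rw [mul_left_comm, ← rpow_add hM0, add_neg_cancel, rpow_zero, mul_one]
  refine ⟨?_, ?_, hint p _ (by positivity) |>.trans ?_, ?_⟩
  · rw [hint p _ (exp_pos _)]
    exact ENNReal.mul_lt_top ENNReal.ofReal_lt_top hμ'
  · rw [hint p _ (exp_pos _)]
    exact ENNReal.mul_lt_top ENNReal.ofReal_lt_top hμ'
  · rw [cosh_eq, mul_div_cancel₀ _ two_ne_zero]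
  · rw [powerRHS, hov, lintegral_enorm_rpow_add aemeasurable_const, hsum,
      ENNReal.ofReal_rpow_of_pos (by positivity), ← ENNReal.ofReal_one,
      ← ENNReal.ofReal_add one_pos.le (by positivity), ENNReal.ofReal_rpow_of_pos (by positivity),
      ← mul_assoc, ← ENNReal.ofReal_mul (by positivity), ← rpow_mul c2.le, mul_comm (_ ^ (p - 1))]
    congr 6
    ring

theorem exists_powerRHS_lt {Ω : Type*} [MeasurableSpace Ω] {μ : Measure Ω} (hμ : 0 < μ Set.univ)
    (hμ' : μ Set.univ < ∞) {p q : ℝ} (h : 0 < p * (p - 1) * (q - 1)) :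
    ∃ f g : Ω → ℝ, Measurable f ∧ Measurable g ∧ (∀ x, 0 < f x) ∧ (∀ x, 0 < g x) ∧
      absPowInt p f μ < ∞ ∧ absPowInt p g μ < ∞ ∧
      powerRHS p q f g μ < absPowInt p (fun x => f x + g x) μ := by
  have h0 : p ≠ 0 := by rintro rfl; simp at h
  obtain ⟨u, hu⟩ := exists_logDeficit_pos h
  obtain ⟨h1, h2, h3, h4⟩ := powerRHS_const hμ hμ' h0 q u
  refine ⟨_, _, measurable_const, measurable_const, fun _ => exp_pos u, fun _ => exp_pos (-u),
    h1, h2, ?_⟩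
  have c2 := cosh_pos (p * u)
  rw [h3, h4, ENNReal.mul_lt_mul_iff_left hμ.ne' hμ'.ne, two_cosh_rpow_eq p q u]
  refine (ENNReal.ofReal_lt_ofReal_iff (by positivity)).2 ?_
  exact lt_mul_of_one_lt_right (by positivity) (one_lt_exp_iff.2 hu)

theorem exists_lt_powerRHS {Ω : Type*} [MeasurableSpace Ω] {μ : Measure Ω} (hμ : 0 < μ Set.univ)
    (hμ' : μ Set.univ < ∞) {p q : ℝ} (h : p * (p - 1) * (q - 1) < 0) :
    ∃ f g : Ω → ℝ, Measurable f ∧ Measurable g ∧ (∀ x, 0 < f x) ∧ (∀ x, 0 < g x) ∧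
      absPowInt p f μ < ∞ ∧ absPowInt p g μ < ∞ ∧
      absPowInt p (fun x => f x + g x) μ < powerRHS p q f g μ := by
  have h0 : p ≠ 0 := by rintro rfl; simp at h
  obtain ⟨u, hu⟩ := exists_logDeficit_neg h
  obtain ⟨h1, h2, h3, h4⟩ := powerRHS_const hμ hμ' h0 q u
  refine ⟨_, _, measurable_const, measurable_const, fun _ => exp_pos u, fun _ => exp_pos (-u),
    h1, h2, ?_⟩
  have c2 := cosh_pos (p * u)
  rw [h3, h4, ENNReal.mul_lt_mul_iff_left hμ.ne' hμ'.ne, two_cosh_rpow_eq p q u]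
  refine (ENNReal.ofReal_lt_ofReal_iff (by positivity)).2 ?_
  exact mul_lt_of_lt_one_right (by positivity) (exp_lt_one_iff.2 hu)

/-! ### Assembly of the theorem. -/

theorem theorem1p1 {Ω : Type*} [MeasurableSpace Ω] (μ : Measure Ω)
    {𝕜 : Type*} [RCLike 𝕜] (p : ℝ) :
    -- the inequality for `p ∈ (0, 1] ∪ [2, ∞)`
    (p ∈ Set.Ioc (0 : ℝ) 1 ∪ Set.Ici 2 →
      ∀ f g : Ω → 𝕜, AEMeasurable f μ → AEMeasurable g μ →
        absPowInt p (fun x => f x + g x) μ ≤ mainRHS p f g μ) ∧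
    -- the reversed inequality for `p < 0`
    (p < 0 →
      ∀ f g : Ω → 𝕜, AEMeasurable f μ → AEMeasurable g μ →
        absPowInt p f μ < ∞ → absPowInt p g μ < ∞ →
        mainRHS p f g μ ≤ absPowInt p (fun x => f x + g x) μ) ∧
    -- the reversed inequality for `p ∈ (1, 2)`
    (p ∈ Set.Ioo (1 : ℝ) 2 →
      ∀ f g : Ω → ℝ, AEMeasurable f μ → AEMeasurable g μ →
        (∀ᵐ x ∂μ, 0 ≤ f x) → (∀ᵐ x ∂μ, 0 ≤ g x) →
        mainRHS p f g μ ≤ absPowInt p (fun x => f x + g x) μ) ∧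
    -- sharpness of the power of `Γ̃`: counterexamples exist among the positive functions
    -- on every measure space of finite positive total mass
    (∀ q : ℝ, 0 < μ Set.univ → μ Set.univ < ∞ →
      (2 < p ∧ 1 < q) ∨ (p ∈ Set.Ioo (0 : ℝ) 1 ∧ q < 1) →
      ∃ f g : Ω → ℝ, Measurable f ∧ Measurable g ∧ (∀ x, 0 < f x) ∧ (∀ x, 0 < g x) ∧
        absPowInt p f μ < ∞ ∧ absPowInt p g μ < ∞ ∧
        ¬ absPowInt p (fun x => f x + g x) μ ≤ powerRHS p q f g μ) ∧
    (∀ q : ℝ, 0 < μ Set.univ → μ Set.univ < ∞ →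
      (p < 0 ∧ q < 1) ∨ (p ∈ Set.Ioc (1 : ℝ) 2 ∧ q < 1) →
      ∃ f g : Ω → ℝ, Measurable f ∧ Measurable g ∧ (∀ x, 0 < f x) ∧ (∀ x, 0 < g x) ∧
        absPowInt p f μ < ∞ ∧ absPowInt p g μ < ∞ ∧
        ¬ powerRHS p q f g μ ≤ absPowInt p (fun x => f x + g x) μ) ∧
    -- the cases of equality for `p ∈ (0, 1) ∪ (2, ∞)`
    (p ∈ Set.Ioo (0 : ℝ) 1 ∪ Set.Ioi 2 →
      ∀ f g : Ω → 𝕜, AEMeasurable f μ → AEMeasurable g μ →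
        absPowInt p f μ < ∞ → absPowInt p g μ < ∞ →
        (absPowInt p (fun x => f x + g x) μ = mainRHS p f g μ ↔
          μ (Function.support f ∩ Function.support g) = 0 ∨ f =ᵐ[μ] g)) ∧
    -- the cases of equality for `p ∈ (1, 2)`
    (p ∈ Set.Ioo (1 : ℝ) 2 →
      ∀ f g : Ω → ℝ, AEMeasurable f μ → AEMeasurable g μ →
        (∀ᵐ x ∂μ, 0 ≤ f x) → (∀ᵐ x ∂μ, 0 ≤ g x) →
        absPowInt p f μ < ∞ → absPowInt p g μ < ∞ →
        (absPowInt p (fun x => f x + g x) μ = mainRHS p f g μ ↔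
          μ (Function.support f ∩ Function.support g) = 0 ∨ f =ᵐ[μ] g)) ∧
    -- the cases of equality for `p < 0`
    (p < 0 →
      ∀ f g : Ω → 𝕜, AEMeasurable f μ → AEMeasurable g μ →
        absPowInt p f μ < ∞ → absPowInt p g μ < ∞ →
        (absPowInt p (fun x => f x + g x) μ = mainRHS p f g μ ↔ f =ᵐ[μ] g)) := by
  have signNeg : p < 0 → p * (p - 1) * (p - 2) < 0 := fun h =>
    mul_neg_of_pos_of_neg (mul_pos_of_neg_of_neg h (by linarith)) (by linarith)
  have signUpper : p ∈ Set.Ioo (0 : ℝ) 1 ∪ Set.Ioi 2 → 0 < p ∧ 0 < p * (p - 1) * (p - 2) := by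
    rintro (⟨h1, h2⟩ | h)
    · exact ⟨h1, mul_pos_of_neg_of_neg (mul_neg_of_pos_of_neg h1 (by linarith)) (by linarith)⟩
    · have h' : 2 < p := h
      exact ⟨by linarith, mul_pos (mul_pos (by linarith) (by linarith)) (by linarith)⟩
  have signMid : p ∈ Set.Ioo (1 : ℝ) 2 → 0 < p ∧ p * (p - 1) * (p - 2) < 0 := fun h =>
    ⟨by linarith [h.1], mul_neg_of_pos_of_neg
      (mul_pos (by linarith [h.1]) (by linarith [h.1])) (by linarith [h.2])⟩
  refine ⟨?_, ?_, ?_, ?_, ?_, ?_, ?_, ?_⟩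
  · intro hp f g hf hg
    by_cases h1 : p = 1
    · subst h1
      exact absPowInt_add_le_mainRHS_one
    by_cases h2 : p = 2
    · subst h2
      exact absPowInt_add_le_mainRHS_two hf hg
    have hp' : p ∈ Set.Ioo (0 : ℝ) 1 ∪ Set.Ioi 2 :=
      hp.imp (fun h => ⟨h.1, lt_of_le_of_ne h.2 h1⟩) fun h => lt_of_le_of_ne h (Ne.symm h2)
    obtain ⟨hpos, hε⟩ := signUpper hp'
    exact (absPowInt_add_le hpos.le).trans (lintegral_enorm_add_rpow_le_mainRHS hpos hε hf hg)
  · intro hp f g hf hg hfp hgp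
    exact (mainRHS_le_lintegral_enorm_add_rpow_of_finite (signNeg hp) hf hg hfp hgp).trans
      (le_absPowInt_add hp.le)
  · intro hp f g hf hg hf0 hg0
    rw [absPowInt_add_of_enorm_add (enorm_add_of_nonneg hf0 hg0)]
    exact mainRHS_le_lintegral_enorm_add_rpow hp.1 hp.2 hf hg
  · intro q hμ hμ' hpq
    have h : 0 < p * (p - 1) * (q - 1) := by
      rcases hpq with ⟨h1, h2⟩ | ⟨h1, h2⟩
      · exact mul_pos (mul_pos (by linarith) (by linarith)) (by linarith)
      · exact mul_pos_of_neg_of_neg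
          (mul_neg_of_pos_of_neg h1.1 (by linarith [h1.2])) (by linarith)
    obtain ⟨f, g, h1, h2, h3, h4, h5, h6, h7⟩ := exists_powerRHS_lt hμ hμ' h
    exact ⟨f, g, h1, h2, h3, h4, h5, h6, h7.not_ge⟩
  · intro q hμ hμ' hpq
    have h : p * (p - 1) * (q - 1) < 0 := by
      rcases hpq with ⟨h1, h2⟩ | ⟨h1, h2⟩
      · exact mul_neg_of_pos_of_neg (mul_pos_of_neg_of_neg h1 (by linarith)) (by linarith)
      · exact mul_neg_of_pos_of_neg
          (mul_pos (by linarith [h1.1]) (by linarith [h1.1])) (by linarith)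
    obtain ⟨f, g, h1, h2, h3, h4, h5, h6, h7⟩ := exists_lt_powerRHS hμ hμ' h
    exact ⟨f, g, h1, h2, h3, h4, h5, h6, h7.not_ge⟩
  · intro hp f g hf hg hfp hgp
    obtain ⟨hpos, hε⟩ := signUpper hp
    refine absPowInt_add_eq_mainRHS_iff_of_pos hpos hε.ne' hf hg hfp hgp fun h => ?_
    -- The integral for |f| + |g| lies between the two quantities assumed equal, so equality holds
    -- in the triangle step too.
    exact le_antisymm (absPowInt_add_le hpos.le)
      ((lintegral_enorm_add_rpow_le_mainRHS hpos hε hf hg).trans_eq h.symm)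
  · intro hp f g hf hg hf0 hg0 hfp hgp
    obtain ⟨hpos, hε⟩ := signMid hp
    exact absPowInt_add_eq_mainRHS_iff_of_pos hpos hε.ne hf hg hfp hgp fun _ =>
      absPowInt_add_of_enorm_add (enorm_add_of_nonneg hf0 hg0)
  · intro hp f g hf hg hfp hgp
    by_cases hd : μ (Function.support f ∩ Function.support g) = 0
    -- For p < 0 disjoint supports occur only for the zero measure, where both sides vanish and any
    -- two functions agree almost everywhere.
    · have hμ := measure_eq_zero_of_disjoint_support_of_neg hp hf hg hfp hgp hd
      subst hμ
      simp [absPowInt, mainRHS, EventuallyEq]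
    · refine absPowInt_add_eq_mainRHS_iff (signNeg hp).ne hf hg hfp hgp hd fun h => ?_
      exact le_antisymm (h.le.trans
        (mainRHS_le_lintegral_enorm_add_rpow_of_finite (signNeg hp) hf hg hfp hgp))
        (le_absPowInt_add hp.le)
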